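/- All graphs are finite and simple. A graph $G$ is $(k,d)$-colourable if each vertex can be assigned one of $k$ colours so that every vertex has at most $d$ neighbours of its own colour. The defective chromatic number of a graph class $\mathcal C$ is the minimum integer $k$ for which there is an integer $d$ such that every graph in $\mathcal C$ is $(k,d)$-colourable. A graph is $H$-minor-free if it does not contain $H$ as a minor. The tree-depth of a connected graph $H$ is the minimum height of a rooted tree $T$ such that $H$ is a subgraph of the closure of $T$; here the height is the maximum number of vertices on a root-to-leaf path, and the closure is obtained by adding an edge between every ancestor and descendant. The tree-depth of a disconnected graph is the maximum tree-depth of its connected components. (1) For every graph $H$ of tree-depth $3$ with at most one component of tree-depth $3$, the defective chromatic number of the class of $H$-minor-free graphs equals $2$. (2) There is an absolute constant $C$ such that, for all integers $\ell\ge 2$ and $k\ge 1$, if $H$ is the graph obtained from $\ell$ disjoint copies of $K_{1,k}$ by adding one dominant vertex (a new vertex adjacent to all others), then every $H$-minor-free graph is $(2,\,C\,\ell^{10}k^{3})$-colourable. -/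

import Mathlib

universe u v

namespace DefectiveColouring

/-- `G` is `(k, d)`-colourable: each vertex gets one of `k` colours so that every vertex has at
most `d` neighbours of its own colour. -/
def DefectColourable {V : Type u} (G : SimpleGraph V) (k d : ℕ) : Prop :=
  ∃ c : V → Fin k, ∀ x : V, {y : V | G.Adj x y ∧ c y = c x}.encard ≤ (d : ℕ∞)

/-- `k` is the defective chromatic number of the graph class `𝒞`: the least `k` for which there is
`d` such that every graph in `𝒞` is `(k, d)`-colourable. -/
def IsDefectiveChromaticNumber (𝒞 : (V : Type u) → SimpleGraph V → Prop) (k : ℕ) : Prop :=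
  IsLeast {k : ℕ | ∃ d : ℕ, ∀ (V : Type u) (G : SimpleGraph V), 𝒞 V G → DefectColourable G k d} k

/-- `H` is a minor of `G`. The branch set `B w` is the set of vertices that are contracted to the
vertex `w` of `H`; vertices in no branch set, and superfluous edges, are deleted. -/
def IsMinor {W : Type v} {V : Type u} (H : SimpleGraph W) (G : SimpleGraph V) : Prop :=
  ∃ B : W → Set V,
    (∀ w, (G.induce (B w)).Connected) ∧
    (∀ w₁ w₂, w₁ ≠ w₂ → Disjoint (B w₁) (B w₂)) ∧
    (∀ w₁ w₂, H.Adj w₁ w₂ → ∃ x ∈ B w₁, ∃ y ∈ B w₂, G.Adj x y)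

/-- The class of (finite) `H`-minor-free graphs. -/
def MinorFree {W : Type v} (H : SimpleGraph W) (V : Type u) (G : SimpleGraph V) : Prop :=
  Finite V ∧ ¬ IsMinor H G

/-- In the tree `T` rooted at `r`, the vertex `x` is an ancestor of `y` (or `y` itself): it lies on
the path from `r` to `y`. -/
def IsAncestor {V : Type u} (T : SimpleGraph V) (r x y : V) : Prop :=
  ∃ p : T.Path r y, x ∈ (p : T.Walk r y).support

/-- The closure of the tree `T` rooted at `r`: an edge between any two distinct vertices one of
which is an ancestor of the other. -/
def treeClosure {V : Type u} (T : SimpleGraph V) (r : V) : SimpleGraph V where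
  Adj x y := x ≠ y ∧ (IsAncestor T r x y ∨ IsAncestor T r y x)
  symm := ⟨fun _ _ h => ⟨h.1.symm, h.2.symm⟩⟩
  loopless := ⟨fun _ h => h.1 rfl⟩

/-- The height of the tree `T` rooted at `r`: the maximum number of vertices on a path that starts
at the root (a longest such path ends at a leaf). -/
noncomputable def treeHeight {V : Type u} (T : SimpleGraph V) (r : V) : ℕ∞ :=
  ⨆ (y : V) (p : T.Path r y), ((p : T.Walk r y).support.length : ℕ∞)

/-- The tree-depth of a connected finite graph `H`: the minimum height of a finite rooted tree such
that `H` is (isomorphic to) a subgraph of its closure. -/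
noncomputable def connectedTreeDepth {W : Type v} (H : SimpleGraph W) : ℕ∞ :=
  sInf {h : ℕ∞ | ∃ (n : ℕ) (T : SimpleGraph (Fin n)) (r : Fin n),
    T.IsTree ∧ treeHeight T r = h ∧ H.IsContained (treeClosure T r)}

/-- The tree-depth of a finite graph: the maximum of the tree-depths of its components. -/
noncomputable def treeDepth {W : Type v} (H : SimpleGraph W) : ℕ∞ :=
  ⨆ c : H.ConnectedComponent, connectedTreeDepth c.toSimpleGraph

/-- `ℓ` pairwise disjoint copies of `G`. -/
def disjointCopies {V : Type u} (ℓ : ℕ) (G : SimpleGraph V) : SimpleGraph (Fin ℓ × V) where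
  Adj x y := x.1 = y.1 ∧ G.Adj x.2 y.2
  symm := ⟨fun _ _ h => ⟨h.1.symm, h.2.symm⟩⟩
  loopless := ⟨fun _ h => h.2.ne rfl⟩

/-- `G` with one new vertex `none`, adjacent to all vertices of `G`. -/
def addDominant {V : Type u} (G : SimpleGraph V) : SimpleGraph (Option V) where
  Adj x y := x ≠ y ∧ ∀ a b : V, x = some a → y = some b → G.Adj a b
  symm := ⟨fun _ _ h => ⟨h.1.symm, fun a b ha hb => (h.2 b a hb ha).symm⟩⟩
  loopless := ⟨fun _ h => h.1 rfl⟩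

/-- The graph obtained from `ℓ` disjoint copies of the star `K_{1,k}` by adding one dominant
vertex. -/
def dominatedStars (ℓ k : ℕ) : SimpleGraph (Option (Fin ℓ × (Fin 1 ⊕ Fin k))) :=
  addDominant (disjointCopies ℓ (completeBipartiteGraph (Fin 1) (Fin k)))

end DefectiveColouring

/-!
For the upper bound, start at a vertex `r` of a graph without the minor `dominatedStars ℓ k`, and
extend it to a maximal sequence of *hubs*, each with many *links* to the earlier hubs: common
neighbours outside of them. Join two hubs in the *link graph* if more than `ℓ * k` vertices link
them. If the link graph is connected, then a hub has at most `2 * ℓ` neighbours among the hubs: of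
more, `ℓ` could be taken, with some of their links, as the stars of a minor in which the remaining
hubs are contracted to the dominant vertex. If it is not, contract each of its components, together
with the links assigned to it; for the same reason, the first hub of each component but one sends
links to many other components, and the resulting minor is dense enough to contain
`dominatedStars ℓ k`.

So the hubs induce a graph of small degree, and, by maximality, each other vertex has few links to
them. Contract the hubs and their neighbours to a new root, colour the contraction recursively, and
give the hubs the colour that the root has not, so that the neighbours of a hub that have its colour
are hubs. The defect does not accumulate: the only vertices to gain neighbours of their own colour
are those contracted to the root and the neighbours of the root of the same colour, and what they
gain are links. As the root was a hub in the contraction, these vertices had small defect there.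

Every graph of tree-depth three with one component of depth three is contained in some
`dominatedStars ℓ k`. Conversely, a minor of a star has tree-depth at most two, so stars are in the
class, and they are not colourable with one colour and bounded defect.
-/

namespace DefectiveColouring

section Minors

variable {V W X : Type*} {G : SimpleGraph V} {S T : Set V} {a b c : V}

/-- `b` is the end of a walk of `G` that starts at `a` and has all its other vertices in `S`. -/
def ReachableIn (G : SimpleGraph V) (S : Set V) (a b : V) : Prop :=
  Relation.ReflTransGen (fun x y => G.Adj x y ∧ y ∈ S) a b

lemma ReachableIn.refl (G : SimpleGraph V) (S : Set V) (a : V) : ReachableIn G S a a :=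
  Relation.ReflTransGen.refl

lemma ReachableIn.tail (h : ReachableIn G S a b) (hbc : G.Adj b c) (hc : c ∈ S) :
    ReachableIn G S a c :=
  Relation.ReflTransGen.tail h ⟨hbc, hc⟩

lemma ReachableIn.trans (h₁ : ReachableIn G S a b) (h₂ : ReachableIn G S b c) :
    ReachableIn G S a c :=
  Relation.ReflTransGen.trans h₁ h₂

lemma ReachableIn.mono (h : ReachableIn G S a b) (hST : S ⊆ T) : ReachableIn G T a b :=
  Relation.ReflTransGen.mono (fun _ _ h => ⟨h.1, hST h.2⟩) _ _ h

lemma ReachableIn.mem (h : ReachableIn G S a b) (ha : a ∈ S) : b ∈ S := by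
  cases h with
  | refl => exact ha
  | tail _ h => exact h.2

lemma connected_induce_of_reachableIn (ha : a ∈ S) (h : ∀ x ∈ S, ReachableIn G S a x) :
    (G.induce S).Connected := by
  have reachable : ∀ x, ReachableIn G S a x →
      ∃ hx : x ∈ S, (G.induce S).Reachable ⟨a, ha⟩ ⟨x, hx⟩ := by
    intro x hx
    induction hx with
    | refl => exact ⟨ha, .rfl⟩
    | tail _ hxy ih =>
      obtain ⟨hx, ih⟩ := ih
      exact ⟨hxy.2, ih.trans (SimpleGraph.Adj.reachable hxy.1)⟩
  rw [SimpleGraph.connected_iff_exists_forall_reachable]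
  exact ⟨⟨a, ha⟩, fun ⟨x, hx⟩ => (reachable x (h x hx)).2⟩

lemma reachableIn_of_connected_induce (h : (G.induce S).Connected) (ha : a ∈ S) (hb : b ∈ S) :
    ReachableIn G S a b := by
  suffices ∀ x : S, (G.induce S).Reachable ⟨a, ha⟩ x → ReachableIn G S a x from
    this ⟨b, hb⟩ (h.preconnected _ _)
  intro x hx
  rw [SimpleGraph.reachable_iff_reflTransGen] at hx
  induction hx with
  | refl => exact .refl G S a
  | tail _ hxy ih => exact ih.tail hxy (Subtype.prop _)

lemma connected_induce_setOf_reachableIn (G : SimpleGraph V) (S : Set V) (a : V) :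
    (G.induce {x | ReachableIn G S a x}).Connected := by
  refine connected_induce_of_reachableIn (a := a) (.refl G S a) fun x hx => ?_
  induction hx with
  | refl => exact .refl G _ a
  | tail hx hxy ih => exact ih.tail hxy.1 (ReachableIn.tail hx hxy.1 hxy.2)

lemma connected_induce_singleton (G : SimpleGraph V) (x : V) : (G.induce {x}).Connected :=
  connected_induce_of_reachableIn rfl (by rintro _ rfl; exact .refl G _ _)

lemma connected_induce_biUnion {Q : SimpleGraph X} {I : Set X} {B : X → Set V}
    (hI : (Q.induce I).Connected) (hB : ∀ x ∈ I, (G.induce (B x)).Connected)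
    (hadj : ∀ x ∈ I, ∀ y ∈ I, Q.Adj x y → ∃ p ∈ B x, ∃ q ∈ B y, G.Adj p q) :
    (G.induce (⋃ x ∈ I, B x)).Connected := by
  have hsub : ∀ {x}, x ∈ I → B x ⊆ ⋃ x ∈ I, B x := fun hx =>
    Set.subset_biUnion_of_mem (u := B) hx
  obtain ⟨⟨x₀, hx₀⟩⟩ := hI.nonempty
  obtain ⟨⟨v₀, hv₀⟩⟩ := (hB x₀ hx₀).nonempty
  have reach : ∀ x, ReachableIn Q I x₀ x → x ∈ I ∧
      ∀ y ∈ B x, ReachableIn G (⋃ x ∈ I, B x) v₀ y := by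
    intro x hx
    induction hx with
    | refl =>
      exact ⟨hx₀, fun y hy =>
        (reachableIn_of_connected_induce (hB x₀ hx₀) hv₀ hy).mono (hsub hx₀)⟩
    | tail _ hxy ih =>
      obtain ⟨p, hp, q, hq, hpq⟩ := hadj _ ih.1 _ hxy.2 hxy.1
      exact ⟨hxy.2, fun y hy => ((ih.2 p hp).tail hpq (hsub hxy.2 hq)).trans
        ((reachableIn_of_connected_induce (hB _ hxy.2) hq hy).mono (hsub hxy.2))⟩
  refine connected_induce_of_reachableIn (hsub hx₀ hv₀) fun y hy => ?_
  obtain ⟨x, hx, hyx⟩ := Set.mem_iUnion₂.1 hy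
  exact (reach x (reachableIn_of_connected_induce hI hx₀ hx)).2 y hyx

lemma IsMinor.trans {H : SimpleGraph W} {Q : SimpleGraph X} (h₁ : IsMinor H Q)
    (h₂ : IsMinor Q G) : IsMinor H G := by
  obtain ⟨B₁, conn₁, disj₁, adj₁⟩ := h₁
  obtain ⟨B₂, conn₂, disj₂, adj₂⟩ := h₂
  refine ⟨fun w => ⋃ x ∈ B₁ w, B₂ x, fun w => ?_, fun w₁ w₂ hw => ?_, fun w₁ w₂ hw => ?_⟩
  · exact connected_induce_biUnion (conn₁ w) (fun x _ => conn₂ x) fun x _ y _ hxy =>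
      adj₂ x y hxy
  · simp only [Set.disjoint_iUnion_left, Set.disjoint_iUnion_right]
    intro x hx y hy
    exact disj₂ _ _ (by rintro rfl; exact Set.disjoint_left.1 (disj₁ _ _ hw) hy hx)
  · obtain ⟨x, hx, y, hy, hxy⟩ := adj₁ _ _ hw
    obtain ⟨p, hp, q, hq, hpq⟩ := adj₂ _ _ hxy
    exact ⟨p, Set.mem_biUnion hx hp, q, Set.mem_biUnion hy hq, hpq⟩

lemma isMinor_of_isContained {Q : SimpleGraph X} (h : Q.IsContained G) : IsMinor Q G := by
  obtain ⟨f⟩ := h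
  refine ⟨fun x => {f x}, fun x => connected_induce_singleton G _, fun x y hxy => ?_,
    fun x y hxy => ⟨f x, rfl, f y, rfl, f.toHom.map_adj hxy⟩⟩
  exact Set.disjoint_singleton.2 (f.injective.ne hxy)

/-- The graph on the index set `X` in which two indices are adjacent if an edge of `G` joins their
sets. For disjoint connected sets, it arises by contracting each of them and deleting the vertices
outside of them. -/
def branchGraph (G : SimpleGraph V) (B : X → Set V) : SimpleGraph X where
  Adj a b := a ≠ b ∧ ∃ x ∈ B a, ∃ y ∈ B b, G.Adj x y
  symm := ⟨fun _ _ ⟨hab, x, hx, y, hy, hxy⟩ => ⟨hab.symm, y, hy, x, hx, hxy.symm⟩⟩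
  loopless := ⟨fun _ h => h.1 rfl⟩

lemma isMinor_branchGraph {B : X → Set V} (hconn : ∀ x, (G.induce (B x)).Connected)
    (hdisj : Pairwise (Function.onFun Disjoint B)) : IsMinor (branchGraph G B) G :=
  ⟨B, hconn, fun _ _ h => hdisj h, fun _ _ h => h.2⟩

lemma isMinor_addDominant {Q : SimpleGraph X} (f : SimpleGraph.Copy Q G) {D : Set V}
    (hD : (G.induce D).Connected) (hfD : ∀ x, f x ∉ D) (hadj : ∀ x, ∃ y ∈ D, G.Adj (f x) y) :
    IsMinor (addDominant Q) G := by
  refine ⟨fun o => o.elim D fun x => {f x}, ?_, ?_, ?_⟩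
  · rintro (_ | x)
    exacts [hD, connected_induce_singleton G _]
  · rintro (_ | x) (_ | y) hxy
    · exact absurd rfl hxy
    · exact Set.disjoint_singleton_right.2 (hfD y)
    · exact Set.disjoint_singleton_left.2 (hfD x)
    · exact Set.disjoint_singleton.2 (f.injective.ne fun h => hxy (congrArg some h))
  · rintro (_ | x) (_ | y) ⟨hxy, h⟩
    · exact absurd rfl hxy
    · obtain ⟨z, hz, hyz⟩ := hadj y
      exact ⟨z, hz, f y, rfl, hyz.symm⟩
    · obtain ⟨z, hz, hxz⟩ := hadj x
      exact ⟨f x, rfl, z, hz, hxz⟩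
    · exact ⟨f x, rfl, f y, rfl, f.toHom.map_adj (h x y rfl rfl)⟩

lemma isMinor_addDominant_of_reachableIn {Q : SimpleGraph X} (f : SimpleGraph.Copy Q G) {v : V}
    (hv : v ∉ Set.range f)
    (hadj : ∀ x, ∃ y, ReachableIn G (Set.range f)ᶜ v y ∧ G.Adj (f x) y) :
    IsMinor (addDominant Q) G :=
  isMinor_addDominant f (connected_induce_setOf_reachableIn G (Set.range f)ᶜ v)
    (fun x hx => hx.mem hv ⟨x, rfl⟩) hadj

end Minors

section StarForests

variable {V : Type*} {G : SimpleGraph V} {ℓ k : ℕ}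

/-- `ℓ` disjoint copies of `K_{1,k}`: star `i` has centre `(i, inl 0)` and leaves `(i, inr j)`. -/
abbrev starForest (ℓ k : ℕ) : SimpleGraph (Fin ℓ × (Fin 1 ⊕ Fin k)) :=
  disjointCopies ℓ (completeBipartiteGraph (Fin 1) (Fin k))

lemma exists_injective_forall_mem_of_card_le_ncard {ι α : Type*} [Fintype ι] {A : ι → Set α}
    (hA : ∀ i, Fintype.card ι ≤ (A i).ncard) :
    ∃ f : ι → α, Function.Injective f ∧ ∀ i, f i ∈ A i := by
  classical
  have hfin : ∀ i, (A i).Finite := fun i =>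
    Set.finite_of_ncard_pos ((Fintype.card_pos_iff.2 ⟨i⟩).trans_le (hA i))
  obtain ⟨f, hf, hfA⟩ := (Finset.all_card_le_biUnion_card_iff_exists_injective
    fun i => (hfin i).toFinset).1 fun s => by
      rcases s.eq_empty_or_nonempty with rfl | ⟨i, hi⟩
      · exact (Finset.card_empty).trans_le (Nat.zero_le _)
      · calc s.card ≤ Fintype.card ι := s.card_le_univ
          _ ≤ (A i).ncard := hA i
          _ = (hfin i).toFinset.card := Set.ncard_eq_toFinset_card _ _
          _ ≤ _ := Finset.card_le_card
            (Finset.subset_biUnion_of_mem (fun i => (hfin i).toFinset) hi)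
  exact ⟨f, hf, fun i => (hfin i).mem_toFinset.1 (hfA i)⟩

lemma exists_copy_starForest {c : Fin ℓ → V} (hc : Function.Injective c) {A : Fin ℓ → Set V}
    (hA : ∀ i, ℓ * k ≤ (A i).ncard) (hadj : ∀ i, ∀ y ∈ A i, G.Adj (c i) y)
    (hcA : ∀ i j, c j ∉ A i) :
    ∃ f : SimpleGraph.Copy (starForest ℓ k) G,
      (∀ i a, f (i, Sum.inl a) = c i) ∧ ∀ i j, f (i, Sum.inr j) ∈ A i := by
  obtain ⟨leaf, leaf_injective, leaf_mem⟩ :=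
    exists_injective_forall_mem_of_card_le_ncard (ι := Fin ℓ × Fin k) (A := fun x => A x.1)
      fun x => by simpa using hA x.1
  let f : Fin ℓ × (Fin 1 ⊕ Fin k) → V := fun x => x.2.elim (fun _ => c x.1) fun j => leaf (x.1, j)
  have hom : ∀ {x y}, (starForest ℓ k).Adj x y → G.Adj (f x) (f y) := by
    rintro ⟨i, a | j⟩ ⟨i', a' | j'⟩ ⟨hi, h⟩ <;> obtain rfl : i = i' := hi
    · simp at h
    · exact hadj i _ (leaf_mem (i, j'))
    · exact (hadj i _ (leaf_mem (i, j))).symm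
    · simp at h
  have inj : Function.Injective f := by
    rintro ⟨i, a | j⟩ ⟨i', a' | j'⟩ h <;>
      simp only [f, Sum.elim_inl, Sum.elim_inr] at h
    · rw [hc h, Subsingleton.elim a a']
    · exact absurd (h ▸ leaf_mem (i', j')) (hcA i' i)
    · exact absurd (h ▸ leaf_mem (i, j)) (hcA i i')
    · obtain ⟨rfl, rfl⟩ := Prod.mk.inj (leaf_injective h)
      rfl
  exact ⟨⟨⟨f, hom⟩, inj⟩, fun _ _ => rfl, fun i j => leaf_mem (i, j)⟩

end StarForests

section Contraction

variable {V : Type*} {G : SimpleGraph V} {U : Set V}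

/-- The branch sets of the contraction of `U`: the vertex `none` stands for `U`, and every vertex
outside `U` for itself. -/
def contractFibre (U : Set V) (o : Option {z // z ∉ U}) : Set V :=
  o.elim U fun z => {z.1}

/-- The graph obtained from `G` by contracting `U` to the vertex `none`. -/
abbrev contractSet (G : SimpleGraph V) (U : Set V) : SimpleGraph (Option {z // z ∉ U}) :=
  branchGraph G (contractFibre U)

lemma contractSet_adj_none_some {z : {z // z ∉ U}} :
    (contractSet G U).Adj none (some z) ↔ ∃ x ∈ U, G.Adj x z := by
  simp [branchGraph, contractFibre]

lemma contractSet_adj_some_none {z : {z // z ∉ U}} :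
    (contractSet G U).Adj (some z) none ↔ ∃ x ∈ U, G.Adj z x := by
  simp [branchGraph, contractFibre]

lemma contractSet_adj_some_some {y z : {z // z ∉ U}} :
    (contractSet G U).Adj (some y) (some z) ↔ G.Adj y z := by
  simpa [branchGraph, contractFibre] using fun h : G.Adj y z => Subtype.coe_ne_coe.1 h.ne

lemma isMinor_contractSet (hU : (G.induce U).Connected) : IsMinor (contractSet G U) G := by
  refine isMinor_branchGraph ?_ ?_
  · rintro (_ | z)
    exacts [hU, connected_induce_singleton G _]
  · rintro (_ | y) (_ | z) hyz
    · exact absurd rfl hyz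
    · exact Set.disjoint_singleton_right.2 z.2
    · exact Set.disjoint_singleton_left.2 y.2
    · exact Set.disjoint_singleton.2 fun h => hyz (congrArg some (Subtype.ext h))

lemma card_contractSet_add_ncard [Finite V] (U : Set V) :
    Nat.card (Option {z // z ∉ U}) + U.ncard = Nat.card V + 1 := by
  rw [Finite.card_option, ← Set.ncard_add_ncard_compl U, add_right_comm, add_comm U.ncard]
  rfl

end Contraction

section Density

variable {V : Type*} {G : SimpleGraph V} {ℓ k : ℕ}

lemma exists_edgeSet_subset_contractSet_pair (G : SimpleGraph V) (x y : V) :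
    ∃ lift : Sym2 (Option {z // z ∉ ({x, y} : Set V)}) → Sym2 V,
      G.edgeSet ⊆ insert s(x, y)
        ((s(y, ·)) '' G.commonNeighbors x y ∪ lift '' (contractSet G {x, y}).edgeSet) := by
  classical
  let expand : Option {z // z ∉ ({x, y} : Set V)} → V := fun o => o.elim x Subtype.val
  -- An edge of the contraction at `none` comes from an edge at `x`, or else from one at `y`.
  let lift : Sym2 (Option {z // z ∉ ({x, y} : Set V)}) → Sym2 V := fun e =>
    if e.map expand ∈ G.edgeSet then e.map expand else (e.map expand).map (Equiv.swap x y)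
  have cover_of_notMem : ∀ a b, G.Adj b a → a ∉ ({x, y} : Set V) →
      s(b, a) ∈ (s(y, ·)) '' G.commonNeighbors x y ∪ lift '' (contractSet G {x, y}).edgeSet := by
    intro a b hba ha
    by_cases hb : b ∈ ({x, y} : Set V)
    · have hadj : s(none, some ⟨a, ha⟩) ∈ (contractSet G {x, y}).edgeSet :=
        contractSet_adj_none_some.2 ⟨b, hb, hba⟩
      by_cases hxa : G.Adj x a
      · rcases hb with rfl | rfl
        · exact Or.inr ⟨s(none, some ⟨a, ha⟩), hadj, if_pos hxa⟩
        · exact Or.inl ⟨a, ⟨hxa, hba⟩, rfl⟩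
      · obtain rfl : b = y := hb.resolve_left fun h => hxa (h ▸ hba)
        refine Or.inr ⟨s(none, some ⟨a, ha⟩), hadj, (if_neg hxa).trans ?_⟩
        simp [expand, Equiv.swap_apply_of_ne_of_ne (fun h => ha (Or.inl h)) hba.ne']
    · exact Or.inr ⟨s(some ⟨b, hb⟩, some ⟨a, ha⟩), contractSet_adj_some_some.2 hba, if_pos hba⟩
  refine ⟨lift, fun e => ?_⟩
  induction e with | _ a b
  intro hab
  by_cases ha : a ∈ ({x, y} : Set V)
  · by_cases hb : b ∈ ({x, y} : Set V)
    · have := G.ne_of_adj hab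
      exact Or.inl (by grind)
    · exact Or.inr (cover_of_notMem b a hab hb)
  · exact Or.inr (Sym2.eq_swap ▸ cover_of_notMem a b (SimpleGraph.Adj.symm hab) ha)

lemma ncard_edgeSet_le_contractSet_pair [Finite V] (G : SimpleGraph V) (x y : V) :
    G.edgeSet.ncard ≤
      (G.commonNeighbors x y).ncard + (contractSet G {x, y}).edgeSet.ncard + 1 := by
  obtain ⟨lift, hlift⟩ := exists_edgeSet_subset_contractSet_pair G x y
  calc G.edgeSet.ncard ≤ _ := Set.ncard_le_ncard hlift
    _ ≤ _ + 1 := Set.ncard_insert_le _ _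
    _ ≤ _ + _ + 1 := Nat.add_le_add_right (Set.ncard_union_le _ _) 1
    _ ≤ (G.commonNeighbors x y).ncard + (contractSet G {x, y}).edgeSet.ncard + 1 := by
      gcongr <;> exact Set.ncard_image_le

lemma isMinor_dominatedStars_of_commonNeighbors [Finite V] {v x : V} (hvx : G.Adj v x)
    (h : ∀ y, G.Adj v y → ℓ * (k + 1) ≤ (G.commonNeighbors v y).ncard) :
    IsMinor (dominatedStars ℓ k) G := by
  obtain ⟨c, c_injective, hc⟩ := exists_injective_forall_mem_of_card_le_ncard (ι := Fin ℓ)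
    (A := fun _ => G.neighborSet v) fun _ => calc
      Fintype.card (Fin ℓ) = ℓ := Fintype.card_fin ℓ
      _ ≤ ℓ * (k + 1) := Nat.le_mul_of_pos_right ℓ k.succ_pos
      _ ≤ (G.commonNeighbors v x).ncard := h x hvx
      _ ≤ (G.neighborSet v).ncard := Set.ncard_le_ncard Set.inter_subset_left
  have card_range : (Set.range c).ncard = ℓ := by
    rw [← Set.image_univ, Set.ncard_image_of_injective _ c_injective, Set.ncard_univ, Nat.card_fin]
  obtain ⟨f, f_centre, f_leaf⟩ := exists_copy_starForest (G := G) (k := k) c_injective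
    (A := fun i => G.commonNeighbors v (c i) \ Set.range c)
    (fun i => by
      have := Set.le_ncard_sdiff (Set.range c) (G.commonNeighbors v (c i))
      have := h (c i) (hc i)
      rw [Nat.mul_succ] at this
      omega)
    (fun i y hy => hy.1.2) (fun i j hj => hj.2 ⟨j, rfl⟩)
  have adj_f : ∀ x, G.Adj v (f x) := by
    rintro ⟨i, a | j⟩
    · exact f_centre i a ▸ hc i
    · exact (f_leaf i j).1.1
  exact isMinor_addDominant f (connected_induce_singleton G v) (fun x => (adj_f x).ne')
    fun x => ⟨v, rfl, (adj_f x).symm⟩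

/-- Contracting an edge destroys one more edge than its ends have common neighbours. If every edge
has many common neighbours, the minor is found around any vertex; otherwise contract an edge with
few of them, which preserves the average degree. -/
theorem isMinor_dominatedStars_of_dense [Finite V] [Nonempty V] (hℓ : 1 ≤ ℓ)
    (h : ℓ * (k + 1) * Nat.card V ≤ G.edgeSet.ncard) : IsMinor (dominatedStars ℓ k) G := by
  induction hn : Nat.card V generalizing V with
  | zero => exact absurd hn Nat.card_pos.ne'
  | succ n ih =>
    have edges_pos : 0 < G.edgeSet.ncard :=
      (Nat.mul_pos (Nat.mul_pos hℓ k.succ_pos) Nat.card_pos).trans_le h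
    obtain ⟨e, he⟩ := (Set.ncard_pos).1 edges_pos
    induction e with | _ v x
    by_cases hcommon : ∀ y, G.Adj v y → ℓ * (k + 1) ≤ (G.commonNeighbors v y).ncard
    · exact isMinor_dominatedStars_of_commonNeighbors he hcommon
    · push Not at hcommon
      obtain ⟨y, hvy, hy⟩ := hcommon
      have card_eq : Nat.card (Option {z // z ∉ ({v, y} : Set V)}) = n := by
        have := card_contractSet_add_ncard ({v, y} : Set V)
        rw [Set.ncard_pair hvy.ne] at this
        omega
      have := ncard_edgeSet_le_contractSet_pair G v y
      refine (ih (G := contractSet G {v, y}) ?_ card_eq).trans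
        (isMinor_contractSet (SimpleGraph.induce_pair_connected_of_adj hvy))
      rw [hn, Nat.mul_succ] at h
      rw [card_eq]
      omega

lemma mul_le_ncard_edgeSet_of_lower_neighbors [Finite V] {α : Type*} [Preorder α] (r : V → α)
    {o : V} {d : ℕ} (h : ∀ x ≠ o, d ≤ {y | G.Adj x y ∧ r y < r x}.ncard) :
    (Nat.card V - 1) * d ≤ G.edgeSet.ncard := by
  classical
  have := Fintype.ofFinite V
  rw [Nat.card_eq_fintype_card, ← Finset.card_univ, ← Finset.card_erase_of_mem (Finset.mem_univ o),
    Set.ncard_eq_toFinset_card' G.edgeSet, ← mul_one G.edgeSet.toFinset.card]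
  refine Finset.card_mul_le_card_mul (fun x e => ∃ y, r y < r x ∧ s(x, y) = e) ?_ ?_
  · intro x hx
    refine (h x (Finset.ne_of_mem_erase hx)).trans ?_
    rw [← Set.ncard_image_of_injective _ (Sym2.mkEmbedding x).injective, ← Set.ncard_coe_finset]
    refine Set.ncard_le_ncard ?_
    rintro _ ⟨y, ⟨hxy, hyx⟩, rfl⟩
    simpa [Finset.bipartiteAbove] using ⟨hxy, y, hyx, Or.inl rfl⟩
  · intro e _
    refine Finset.card_le_one.2 fun x hx x' hx' => ?_
    obtain ⟨y, hyx, rfl⟩ := (Finset.mem_filter.1 hx).2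
    obtain ⟨y', hyx', he⟩ := (Finset.mem_filter.1 hx').2
    rcases Sym2.eq_iff.1 he with ⟨h, -⟩ | ⟨rfl, rfl⟩
    exacts [h.symm, absurd hyx (lt_asymm hyx')]

end Density

section RemovableMarks

variable {ι : Type*} {F : SimpleGraph ι} {M : Set ι} {ℓ : ℕ}

lemma exists_bool_colouring_ne_of_lt {α : Type*} (f : α → α) (rank : α → ℕ) :
    ∃ col : α → Bool, ∀ a, rank (f a) < rank a → col (f a) ≠ col a := by
  let wf := (measure rank).wf
  let flip : ∀ a, (∀ b, rank b < rank a → Bool) → Bool := fun a col =>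
    if h : rank (f a) < rank a then !col (f a) h else true
  refine ⟨wf.fix flip, fun a ha => ?_⟩
  rw [wf.fix_eq flip a]
  simp [flip, ha]

lemma exists_subset_ncard_eq_forall_notMem {f : ι → ι} {rank : ι → ℕ} {S : Set ι}
    (hS : 2 * ℓ ≤ S.ncard) (hf : ∀ a ∈ S, rank (f a) < rank a) :
    ∃ I ⊆ S, I.ncard = ℓ ∧ ∀ a ∈ I, f a ∉ I := by
  obtain ⟨col, hcol⟩ := exists_bool_colouring_ne_of_lt f rank
  obtain ⟨i, hi⟩ : ∃ i, ℓ ≤ (S ∩ col ⁻¹' {i}).ncard := by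
    by_contra! h
    have := S.ncard_inter_add_ncard_sdiff_eq_ncard (col ⁻¹' {true})
      (Set.finite_of_ncard_pos (by have := h true; omega))
    have hfalse : S \ col ⁻¹' {true} = S ∩ col ⁻¹' {false} := by ext; simp
    have := hfalse ▸ h false
    have := h true
    omega
  obtain ⟨I, hI, I_card⟩ := Set.exists_subset_card_eq hi
  exact ⟨I, fun a ha => (hI ha).1, I_card, fun a ha h =>
    hcol a (hf a (hI ha).1) ((hI h).2.trans (hI ha).2.symm)⟩

lemma exists_mem_reachableIn_compl {x b : ι} (p : F.Walk x b) (hb : b ∈ M) :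
    ∃ c ∈ M, (∃ q : F.Walk c b, q.length ≤ p.length) ∧ ReachableIn F Mᶜ c x := by
  induction p with
  | nil => exact ⟨_, hb, ⟨.nil, le_rfl⟩, .refl F _ _⟩
  | @cons x y b hxy p ih =>
    by_cases hx : x ∈ M
    · exact ⟨x, hx, ⟨.cons hxy p, le_rfl⟩, .refl F _ _⟩
    · obtain ⟨c, hc, ⟨q, hq⟩, hcy⟩ := ih hb
      exact ⟨c, hc, ⟨q, hq.trans (Nat.le_succ _)⟩, hcy.tail hxy.symm hx⟩

/-- Keep one mark per component as its base. From any other mark, follow a shortest path towards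
the base up to the next mark; two-colour the marks so that each differs from its successor, and
take the larger colour class. -/
lemma exists_removable_marks [Finite ι]
    (hM : (F.connectedComponentMk '' M).ncard + 2 * ℓ ≤ M.ncard) :
    ∃ I ⊆ M, I.ncard = ℓ ∧
      ∀ a ∈ I, ∃ a', F.Adj a a' ∧ ∃ c ∈ M \ I, ReachableIn F Iᶜ c a' := by
  obtain ⟨A, hAM, hA⟩ := (Set.surjOn_image F.connectedComponentMk M).exists_bijOn_subset
  have hbase : ∀ a ∈ M, ∃ b ∈ A, F.connectedComponentMk b = F.connectedComponentMk a :=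
    fun a ha => hA.surjOn ⟨a, ha, rfl⟩
  choose! base base_mem base_eq using hbase
  let rank : ι → ℕ := fun a => F.dist a (base a)
  have exists_next : ∀ a ∈ M \ A, ∃ c ∈ M, rank c < rank a ∧
      ∃ a', F.Adj a a' ∧ ReachableIn F Mᶜ c a' := by
    rintro a ⟨ha, haA⟩
    have reachable : F.Reachable a (base a) :=
      (SimpleGraph.ConnectedComponent.exact (base_eq a ha)).symm
    obtain ⟨p, hp⟩ := reachable.exists_walk_length_eq_dist
    obtain ⟨a', haa', p, rfl⟩ := p.exists_eq_cons_of_ne fun h : a = base a =>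
      haA (h.symm ▸ base_mem a ha)
    obtain ⟨c, hc, ⟨q, hq⟩, hca'⟩ := exists_mem_reachableIn_compl p (hAM (base_mem a ha))
    have base_c : base c = base a := hA.injOn (base_mem c hc) (base_mem a ha)
      ((base_eq c hc).trans (SimpleGraph.ConnectedComponent.sound q.reachable))
    refine ⟨c, hc, ?_, a', haa', hca'⟩
    calc rank c = F.dist c (base a) := by simp only [rank, base_c]
      _ ≤ p.length := (SimpleGraph.dist_le q).trans hq
      _ < rank a := Nat.lt_of_succ_le hp.le
  choose! next next_mem rank_next next_reach using exists_next
  have card_diff : 2 * ℓ ≤ (M \ A).ncard := by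
    have := hA.image_eq ▸ hA.injOn.ncard_image
    have := Set.le_ncard_sdiff A M
    omega
  obtain ⟨I, hI, I_card, next_notMem⟩ := exists_subset_ncard_eq_forall_notMem card_diff rank_next
  refine ⟨I, fun a ha => (hI ha).1, I_card, fun a ha => ?_⟩
  obtain ⟨a', haa', hreach⟩ := next_reach a (hI ha)
  exact ⟨a', haa', next a, ⟨next_mem a (hI ha), next_notMem a ha⟩,
    hreach.mono (Set.compl_subset_compl.2 fun a ha => (hI ha).1)⟩

end RemovableMarks

section Links

variable {V ι : Type*} [LinearOrder ι] {G : SimpleGraph V} {w : ι → V} {i j x y : ι} {b : V}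
  {ℓ k m : ℕ}

lemma exists_isLeast_of_nonempty [Finite ι] {s : Set ι} (hs : s.Nonempty) : ∃ x, IsLeast s x :=
  (Set.exists_min_image s id s.toFinite hs).imp fun _ h => h

/-- The common neighbours of `w i` and `w j` outside the sequence `w` (whose terms are called hubs)
that have `w j` as their first neighbour in the sequence. -/
def links (G : SimpleGraph V) (w : ι → V) (i j : ι) : Set V :=
  {b | b ∉ Set.range w ∧ G.Adj b (w i) ∧ IsLeast {j | G.Adj b (w j)} j}

/-- The graph on the indices of the hubs in which two of them are adjacent if at least `m` links
join them, in either direction. -/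
def linkGraph (G : SimpleGraph V) (w : ι → V) (m : ℕ) : SimpleGraph ι where
  Adj i j := i ≠ j ∧ m ≤ (links G w i j ∪ links G w j i).ncard
  symm := ⟨fun _ _ h => ⟨h.1.symm, Set.union_comm _ _ ▸ h.2⟩⟩
  loopless := ⟨fun _ h => h.1 rfl⟩

lemma adj_of_mem_links_union (hb : b ∈ links G w i j ∪ links G w j i) :
    b ∉ Set.range w ∧ G.Adj b (w i) ∧ G.Adj b (w j) := by
  rcases hb with h | h
  exacts [⟨h.1, h.2.1, h.2.2.1⟩, ⟨h.1, h.2.2.1, h.2.1⟩]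

/-- The stars of `f` are centred at hubs `w a` with `a ∈ I`, and have as leaves links between `a`
and `next a` other than the vertex `avoid (next a)`. -/
def IsLinkStarForest (f : SimpleGraph.Copy (starForest ℓ k) G) (w : ι → V) (I : Set ι)
    (next : ι → ι) (avoid : ι → V) : Prop :=
  ∀ i, ∃ a ∈ I, (∀ z, f (i, Sum.inl z) = w a) ∧
    ∀ j, f (i, Sum.inr j) ∈ (links G w a (next a) ∪ links G w (next a) a) \ {avoid (next a)}

section LinkStarForests

variable {f : SimpleGraph.Copy (starForest ℓ k) G} {I : Set ι} {next : ι → ι} {avoid : ι → V}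

lemma exists_isLinkStarForest (hw : Function.Injective w) (hI : I.ncard = ℓ)
    (hnext : ∀ a ∈ I, (linkGraph G w (ℓ * k + 1)).Adj a (next a)) (avoid : ι → V) :
    ∃ f : SimpleGraph.Copy (starForest ℓ k) G, IsLinkStarForest f w I next avoid := by
  obtain ⟨c, c_injective, hc⟩ := exists_injective_forall_mem_of_card_le_ncard (ι := Fin ℓ)
    (A := fun _ => I) fun _ => by rw [Fintype.card_fin, hI]
  obtain ⟨f, f_centre, f_leaf⟩ := exists_copy_starForest (G := G) (k := k) (hw.comp c_injective)
    (A := fun i => (links G w (c i) (next (c i)) ∪ links G w (next (c i)) (c i)) \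
      {avoid (next (c i))})
    (fun i => by
      have := (hnext (c i) (hc i)).2
      have := Set.pred_ncard_le_ncard_sdiff_singleton
        (links G w (c i) (next (c i)) ∪ links G w (next (c i)) (c i)) (avoid (next (c i)))
      omega)
    (fun i y hy => (adj_of_mem_links_union hy.1).2.1.symm)
    (fun i j hj => (adj_of_mem_links_union hj.1).1 ⟨c j, rfl⟩)
  exact ⟨f, fun i => ⟨c i, hc i, f_centre i, f_leaf i⟩⟩

lemma IsLinkStarForest.ncard_range_diff_le (hf : IsLinkStarForest f w I next avoid) :
    (Set.range f \ Set.range w).ncard ≤ ℓ * k := by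
  have subset : Set.range f \ Set.range w ⊆
      Set.range fun x : Fin ℓ × Fin k => f (x.1, Sum.inr x.2) := by
    rintro _ ⟨⟨⟨i, z | j⟩, rfl⟩, h⟩
    · obtain ⟨a, -, ha, -⟩ := hf i
      exact absurd ⟨a, (ha z).symm⟩ h
    · exact ⟨(i, j), rfl⟩
  calc _ ≤ _ := Set.ncard_le_ncard subset
    _ ≤ Nat.card (Fin ℓ × Fin k) := by
      rw [← Set.image_univ, ← Set.ncard_univ]
      exact Set.ncard_image_le
    _ = ℓ * k := by simp

lemma IsLinkStarForest.exists_link_notMem_range (hf : IsLinkStarForest f w I next avoid)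
    (hxy : (linkGraph G w (ℓ * k + 1)).Adj x y) :
    ∃ b ∈ (Set.range f)ᶜ, G.Adj b (w x) ∧ G.Adj b (w y) := by
  obtain ⟨b, hb, hbf⟩ := Set.exists_mem_notMem_of_ncard_lt_ncard
    ((Nat.lt_succ_of_le hf.ncard_range_diff_le).trans_le hxy.2)
  have adj := adj_of_mem_links_union hb
  exact ⟨b, fun h => hbf ⟨h, adj.1⟩, adj.2⟩

lemma IsLinkStarForest.hub_notMem_range (hf : IsLinkStarForest f w I next avoid)
    (hw : Function.Injective w) (hx : x ∉ I) : w x ∉ Set.range f := by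
  rintro ⟨⟨i, z | j⟩, h⟩ <;> obtain ⟨a, ha, hcentre, hleaf⟩ := hf i
  · exact hx (hw ((hcentre z).symm.trans h) ▸ ha)
  · exact (adj_of_mem_links_union (hleaf j).1).1 ⟨x, h.symm⟩

lemma IsLinkStarForest.avoid_notMem_range (hf : IsLinkStarForest f w I next avoid) (hy : y ∉ I)
    (h : avoid y ∈ links G w x y) : avoid y ∉ Set.range f := by
  rintro ⟨⟨i, z | j⟩, hi⟩ <;> obtain ⟨a, ha, hcentre, hleaf⟩ := hf i
  · exact h.1 ⟨a, (hcentre z).symm.trans hi⟩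
  · obtain ⟨hlink | hlink, hne⟩ := hi ▸ hleaf j
    · exact hne (congrArg avoid (h.2.2.unique hlink.2.2))
    · exact hy (h.2.2.unique hlink.2.2 ▸ ha)

lemma IsLinkStarForest.isMinor_dominatedStars (hf : IsLinkStarForest f w I next avoid)
    (hnext : ∀ a ∈ I, (linkGraph G w (ℓ * k + 1)).Adj a (next a)) {v : V} (hv : v ∉ Set.range f)
    (hreach : ∀ a ∈ I, ReachableIn G (Set.range f)ᶜ v (w (next a))) :
    IsMinor (dominatedStars ℓ k) G := by
  refine isMinor_addDominant_of_reachableIn f hv ?_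
  rintro ⟨i, z | j⟩ <;> obtain ⟨a, ha, hcentre, hleaf⟩ := hf i
  · obtain ⟨b, hb, hba, hbn⟩ := hf.exists_link_notMem_range (hnext a ha)
    exact ⟨b, (hreach a ha).tail hbn.symm hb, hcentre z ▸ hba.symm⟩
  · exact ⟨w (next a), hreach a ha, (adj_of_mem_links_union (hleaf j).1).2.2⟩

end LinkStarForests

lemma reachableIn_of_linkGraph_reachableIn {S : Set V} {I : Set ι} {v : V} (hI : ∀ z ∉ I, w z ∈ S)
    (hlink : ∀ {x y}, (linkGraph G w m).Adj x y → ∃ b ∈ S, G.Adj b (w x) ∧ G.Adj b (w y))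
    (hxy : ReachableIn (linkGraph G w m) Iᶜ x y) (hx : ReachableIn G S v (w x)) :
    ReachableIn G S v (w y) := by
  induction hxy with
  | refl => exact hx
  | tail _ hyz ih =>
    obtain ⟨b, hb, hby, hbz⟩ := hlink hyz.1
    exact (ih.tail hby.symm hb).tail hbz (hI _ hyz.2)

/-- Removing `ℓ` suitable marks leaves the hubs next to them reachable from `ρ` through the other
marks. With some of their links, the removed marks form stars that the rest dominates. -/
lemma ncard_lt_of_not_isMinor_dominatedStars [Finite ι]
    (hG : ¬ IsMinor (dominatedStars ℓ k) G) (hw : Function.Injective w) {ρ : ι} {M : Set ι}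
    (hρ : ρ ∉ M) (hM : ∀ a ∈ M, G.Adj (w ρ) (w a) ∨ (links G w ρ a).Nonempty) :
    M.ncard < ((linkGraph G w (ℓ * k + 1)).connectedComponentMk '' M).ncard + 2 * ℓ := by
  by_contra! hcard
  obtain ⟨I, hIM, hI, hnext⟩ := exists_removable_marks hcard
  choose! next adj_next next_reach using hnext
  have hconnector : ∀ a, ∃ b, a ∈ M → G.Adj (w ρ) (w a) ∨ b ∈ links G w ρ a := by
    intro a
    by_cases h : (links G w ρ a).Nonempty
    · exact h.imp fun _ hb _ => Or.inr hb
    · exact ⟨w a, fun ha => Or.inl ((hM a ha).resolve_right h)⟩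
  choose connector hconnector using hconnector
  obtain ⟨f, hf⟩ := exists_isLinkStarForest hw hI adj_next connector
  have reach_mark : ∀ c ∈ M \ I, ReachableIn G (Set.range f)ᶜ (w ρ) (w c) := by
    intro c hc
    have hub := hf.hub_notMem_range hw hc.2
    rcases hconnector c hc.1 with h | h
    · exact (ReachableIn.refl G _ _).tail h hub
    · exact ((ReachableIn.refl G _ _).tail h.2.1.symm (hf.avoid_notMem_range hc.2 h)).tail
        h.2.2.1 hub
  refine hG (hf.isMinor_dominatedStars adj_next
    (hf.hub_notMem_range hw fun h => hρ (hIM h)) fun a ha => ?_)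
  obtain ⟨c, hc, hca⟩ := next_reach a ha
  exact reachableIn_of_linkGraph_reachableIn (fun _ => hf.hub_notMem_range hw)
    hf.exists_link_notMem_range hca (reach_mark c hc)

end Links

section LinkComponents

variable {V ι : Type*} [LinearOrder ι] {G : SimpleGraph V} {w : ι → V} {x : ι} {ℓ k m : ℕ}

/-- The hub `w x` together with the vertices outside the sequence whose first neighbour in the
sequence it is. -/
def cell (G : SimpleGraph V) (w : ι → V) (x : ι) : Set V :=
  insert (w x) {v | v ∉ Set.range w ∧ IsLeast {j | G.Adj v (w j)} x}

lemma connected_induce_cell (G : SimpleGraph V) (w : ι → V) (x : ι) :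
    (G.induce (cell G w x)).Connected := by
  refine connected_induce_of_reachableIn (Set.mem_insert _ _) ?_
  rintro _ (rfl | hv)
  · exact .refl G _ _
  · exact (ReachableIn.refl G _ _).tail hv.2.1.symm (Or.inr hv)

lemma pairwise_disjoint_cell (hw : Function.Injective w) :
    Pairwise (Function.onFun Disjoint (cell G w)) := by
  refine fun x y hxy => Set.disjoint_left.2 ?_
  rintro _ (rfl | hx) (h | hy)
  · exact hxy (hw h)
  · exact hy.1 ⟨x, rfl⟩
  · exact hx.1 ⟨y, h.symm⟩
  · exact hxy (hx.2.unique hy.2)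

lemma links_subset_cell (i j : ι) : links G w i j ⊆ cell G w j :=
  fun _ h => Or.inr ⟨h.1, h.2.2⟩

/-- The union of the cells of the hubs in a component of the link graph. -/
def componentCells (G : SimpleGraph V) (w : ι → V) (m : ℕ)
    (κ : (linkGraph G w m).ConnectedComponent) : Set V :=
  ⋃ x ∈ κ.supp, cell G w x

lemma cell_subset_componentCells (x : ι) :
    cell G w x ⊆ componentCells G w m ((linkGraph G w m).connectedComponentMk x) :=
  Set.subset_biUnion_of_mem (u := cell G w) rfl

lemma connected_induce_componentCells (κ : (linkGraph G w (m + 1)).ConnectedComponent) :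
    (G.induce (componentCells G w (m + 1) κ)).Connected := by
  refine connected_induce_biUnion κ.connected_toSimpleGraph
    (fun x _ => connected_induce_cell G w x) fun x _ y _ hxy => ?_
  obtain ⟨b, hb⟩ := Set.nonempty_of_ncard_ne_zero (Nat.ne_zero_of_lt hxy.2)
  rcases hb with hb | hb
  · exact ⟨w x, Set.mem_insert _ _, b, links_subset_cell x y hb, hb.2.1.symm⟩
  · exact ⟨b, links_subset_cell y x hb, w y, Set.mem_insert _ _, hb.2.1⟩

lemma pairwise_disjoint_componentCells (hw : Function.Injective w) :
    Pairwise (Function.onFun Disjoint (componentCells G w m)) := by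
  intro κ κ' hκ
  simp only [Function.onFun, componentCells, Set.disjoint_iUnion_left, Set.disjoint_iUnion_right]
  refine fun y hy x hx => pairwise_disjoint_cell hw ?_
  rintro rfl
  exact hκ (hx.symm.trans hy)

/-- The neighbours of `x` outside `W` that also have a neighbour in `W`. -/
def outerLinks (G : SimpleGraph V) (W : Set V) (x : V) : Set V :=
  {b | b ∉ W ∧ G.Adj x b ∧ ∃ u ∈ W, G.Adj b u}

/-- The number of links to earlier hubs required of each hub: enough for `2 * (ℓ * (k + 1)) + 2 * ℓ`
of the earlier hubs to receive one, if none of them receives more than `ℓ * k`. -/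
def linkBound (ℓ k : ℕ) : ℕ :=
  (2 * (ℓ * (k + 1)) + 2 * ℓ) * (ℓ * k + 1)

lemma le_ncard_linked_of_linkBound_le [Finite V] [Finite ι]
    (hx : linkBound ℓ k ≤ (outerLinks G (w '' Set.Iio x) (w x) \ Set.range w).ncard)
    (hadj : ∀ j < x, ¬ (linkGraph G w (ℓ * k + 1)).Adj x j) :
    2 * (ℓ * (k + 1)) + 2 * ℓ ≤ {j | j < x ∧ (links G w x j).Nonempty}.ncard := by
  let T : Set ι := {j | j < x ∧ (links G w x j).Nonempty}
  have T_finite : T.Finite := T.toFinite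
  have cover : outerLinks G (w '' Set.Iio x) (w x) \ Set.range w ⊆
      ⋃ j ∈ T_finite.toFinset, links G w x j := by
    rintro b ⟨⟨-, hxb, _, ⟨u, hu, rfl⟩, hbu⟩, hb⟩
    obtain ⟨j, hj⟩ := exists_isLeast_of_nonempty (s := {j | G.Adj b (w j)}) ⟨u, hbu⟩
    have b_mem : b ∈ links G w x j := ⟨hb, hxb.symm, hj⟩
    exact Set.mem_biUnion (T_finite.mem_toFinset.2 ⟨(hj.2 hbu).trans_lt hu, b, b_mem⟩) b_mem
  have card_links : ∀ j ∈ T_finite.toFinset, (links G w x j).ncard ≤ ℓ * k := by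
    intro j hj
    have hjx := (T_finite.mem_toFinset.1 hj).1
    have := mt (And.intro hjx.ne') (hadj j hjx)
    have := Set.ncard_le_ncard (Set.subset_union_left (s := links G w x j) (t := links G w j x))
    omega
  refine Nat.le_of_mul_le_mul_right (c := ℓ * k + 1) ?_ (Nat.succ_pos _)
  calc linkBound ℓ k ≤ _ := hx
    _ ≤ _ := Set.ncard_le_ncard cover
    _ ≤ ∑ j ∈ T_finite.toFinset, (links G w x j).ncard := Finset.set_ncard_biUnion_le _ _
    _ ≤ T_finite.toFinset.card * (ℓ * k) := Finset.sum_le_card_nsmul _ _ _ card_links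
    _ ≤ T.ncard * (ℓ * k + 1) := by
      rw [← Set.ncard_eq_toFinset_card T T_finite]
      exact Nat.mul_le_mul_left _ (Nat.le_succ _)

section

variable [Finite V] [Finite ι] [OrderBot ι]

lemma exists_le_ncard_lower_neighbors (hG : ¬ IsMinor (dominatedStars ℓ k) G)
    (hw : Function.Injective w)
    (hlinks : ∀ i ≠ ⊥, linkBound ℓ k ≤ (outerLinks G (w '' Set.Iio i) (w i) \ Set.range w).ncard) :
    ∃ r : (linkGraph G w (ℓ * k + 1)).ConnectedComponent → ι,
      ∀ κ ≠ (linkGraph G w (ℓ * k + 1)).connectedComponentMk ⊥, 2 * (ℓ * (k + 1)) ≤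
        {κ' | (branchGraph G (componentCells G w (ℓ * k + 1))).Adj κ κ' ∧ r κ' < r κ}.ncard := by
  let F := linkGraph G w (ℓ * k + 1)
  have exists_least : ∀ κ : F.ConnectedComponent, ∃ x, IsLeast κ.supp x :=
    fun κ => exists_isLeast_of_nonempty κ.nonempty_supp
  choose r hr using exists_least
  refine ⟨r, fun κ hκ => ?_⟩
  have mk_r : F.connectedComponentMk (r κ) = κ := (hr κ).1
  let T : Set ι := {j | j < r κ ∧ (links G w (r κ) j).Nonempty}
  have card_T : 2 * (ℓ * (k + 1)) + 2 * ℓ ≤ T.ncard := by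
    refine le_ncard_linked_of_linkBound_le (hlinks _ fun h => hκ (h ▸ mk_r.symm))
      fun j hj hadj => hj.not_ge ((hr κ).2 ?_)
    exact (SimpleGraph.ConnectedComponent.connectedComponentMk_eq_of_adj hadj).symm.trans mk_r
  have marks := ncard_lt_of_not_isMinor_dominatedStars hG hw (ρ := r κ) (M := T)
    (fun h => h.1.false) fun a ha => Or.inr ha.2
  have components_subset : F.connectedComponentMk '' T ⊆
      {κ' | (branchGraph G (componentCells G w (ℓ * k + 1))).Adj κ κ' ∧ r κ' < r κ} := by
    rintro _ ⟨j, ⟨hj, b, hb⟩, rfl⟩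
    have r_lt : r (F.connectedComponentMk j) < r κ := ((hr _).2 rfl).trans_lt hj
    refine ⟨⟨fun h => r_lt.ne (h ▸ rfl), w (r κ), ?_, b, ?_, hb.2.1.symm⟩, r_lt⟩
    · exact Set.mem_biUnion (hr κ).1 (Set.mem_insert _ _)
    · exact cell_subset_componentCells j (links_subset_cell _ _ hb)
  exact Nat.le_of_add_le_add_right ((card_T.trans_lt marks).le.trans
    (Nat.add_le_add_right (Set.ncard_le_ncard components_subset) _))

/-- Contracting the cells of each component gives a minor in which every component but one has many
lower neighbours. If there were at least two components, this minor would be dense. -/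
lemma subsingleton_connectedComponent_linkGraph (hℓ : 1 ≤ ℓ) (hG : ¬ IsMinor (dominatedStars ℓ k) G)
    (hw : Function.Injective w)
    (hlinks : ∀ i ≠ ⊥, linkBound ℓ k ≤ (outerLinks G (w '' Set.Iio i) (w i) \ Set.range w).ncard) :
    Subsingleton (linkGraph G w (ℓ * k + 1)).ConnectedComponent := by
  rw [← Finite.card_le_one_iff_subsingleton]
  let Q := branchGraph G (componentCells G w (ℓ * k + 1))
  obtain ⟨r, hr⟩ := exists_le_ncard_lower_neighbors hG hw hlinks
  have edges := mul_le_ncard_edgeSet_of_lower_neighbors r hr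
  by_contra! hcard
  refine hG (IsMinor.trans (isMinor_dominatedStars_of_dense (G := Q) hℓ ?_)
    (isMinor_branchGraph connected_induce_componentCells (pairwise_disjoint_componentCells hw)))
  refine le_trans ?_ edges
  set n := Nat.card (linkGraph G w (ℓ * k + 1)).ConnectedComponent
  calc ℓ * (k + 1) * n ≤ ℓ * (k + 1) * ((n - 1) * 2) := Nat.mul_le_mul_left _ (by omega)
    _ = (n - 1) * (2 * (ℓ * (k + 1))) := by ac_rfl

lemma ncard_adj_hub_le (hℓ : 1 ≤ ℓ) (hG : ¬ IsMinor (dominatedStars ℓ k) G)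
    (hw : Function.Injective w)
    (hlinks : ∀ i ≠ ⊥, linkBound ℓ k ≤ (outerLinks G (w '' Set.Iio i) (w i) \ Set.range w).ncard)
    (x : ι) : {a | G.Adj (w x) (w a)}.ncard ≤ 2 * ℓ := by
  have marks := ncard_lt_of_not_isMinor_dominatedStars hG hw (ρ := x)
    (M := {a | G.Adj (w x) (w a)}) (G.loopless.irrefl (w x)) fun a ha => Or.inl ha
  have := subsingleton_connectedComponent_linkGraph hℓ hG hw hlinks
  have := Set.ncard_le_one_of_subsingleton
    ((linkGraph G w (ℓ * k + 1)).connectedComponentMk '' {a | G.Adj (w x) (w a)})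
  omega

end

end LinkComponents

section Hubs

variable {V : Type*} {G : SimpleGraph V} {w : ℕ → V} {x : V} {s p i ℓ k : ℕ}

/-- The vertices `w 0, …, w p` are distinct, and each of them except `w 0` has at least `s` links to
earlier ones. -/
structure IsHubSequence (G : SimpleGraph V) (s : ℕ) (w : ℕ → V) (p : ℕ) : Prop where
  injOn : Set.InjOn w (Set.Iic p)
  le_ncard_outerLinks : ∀ i ≤ p, 0 < i → s ≤ (outerLinks G (w '' Set.Iio i) (w i)).ncard

lemma isHubSequence_zero (G : SimpleGraph V) (s : ℕ) (w : ℕ → V) : IsHubSequence G s w 0 where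
  injOn i hi j hj _ := by simp_all
  le_ncard_outerLinks _ hi hi' := absurd hi hi'.not_ge

lemma IsHubSequence.of_succ (h : IsHubSequence G s w (p + 1)) : IsHubSequence G s w p where
  injOn := h.injOn.mono (Set.Iic_subset_Iic.2 p.le_succ)
  le_ncard_outerLinks i hi := h.le_ncard_outerLinks i (hi.trans p.le_succ)

/-- The number of links required of each hub: as many as `linkBound ℓ k` outside of the sequence, in
addition to those that are later hubs. -/
def hubBound (ℓ k : ℕ) : ℕ :=
  linkBound ℓ k + 2 * ℓ + 1

section Degrees

variable [Finite V]

lemma linkBound_le_ncard_outerLinks_diff (h : hubBound ℓ k ≤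
      (outerLinks G (w '' Set.Iio i) (w i)).ncard)
    (hlater : {j | i ≤ j ∧ j ≤ p ∧ G.Adj (w i) (w j)}.ncard ≤ 2 * ℓ + 1) :
    linkBound ℓ k ≤ (outerLinks G (w '' Set.Iio i) (w i) \ w '' Set.Iic p).ncard := by
  have inter_subset : outerLinks G (w '' Set.Iio i) (w i) ∩ w '' Set.Iic p ⊆
      w '' {j | i ≤ j ∧ j ≤ p ∧ G.Adj (w i) (w j)} := by
    rintro _ ⟨h, j, hj, rfl⟩
    exact ⟨j, ⟨not_lt.1 fun hji => h.1 ⟨j, hji, rfl⟩, hj, h.2.1⟩, rfl⟩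
  have card_inter : (outerLinks G (w '' Set.Iio i) (w i) ∩ w '' Set.Iic p).ncard ≤ 2 * ℓ + 1 :=
    (Set.ncard_le_ncard inter_subset).trans ((Set.ncard_image_le
      ((Set.finite_Iic p).subset fun j hj => hj.2.1)).trans hlater)
  have := (outerLinks G (w '' Set.Iio i) (w i)).ncard_inter_add_ncard_sdiff_eq_ncard
    (w '' Set.Iic p)
  unfold hubBound at h
  omega

lemma IsHubSequence.ncard_adj_le_of_later (hw : IsHubSequence G (hubBound ℓ k) w p) (hℓ : 1 ≤ ℓ)
    (hG : ¬ IsMinor (dominatedStars ℓ k) G)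
    (hlater : ∀ i ≤ p, {j | i ≤ j ∧ j ≤ p ∧ G.Adj (w i) (w j)}.ncard ≤ 2 * ℓ + 1) (hi : i ≤ p) :
    {j | j ≤ p ∧ G.Adj (w i) (w j)}.ncard ≤ 2 * ℓ := by
  let w' : Set.Iic p → V := fun j => w j
  have image_Iio : ∀ j : Set.Iic p, w' '' Set.Iio j = w '' Set.Iio j.1 := by
    intro j
    ext x
    exact ⟨fun ⟨i, hi, h⟩ => ⟨i, hi, h⟩,
      fun ⟨i, hi, h⟩ => ⟨⟨i, (le_of_lt hi).trans (Set.mem_Iic.1 j.2)⟩, hi, h⟩⟩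
  have range_eq : Set.range w' = w '' Set.Iic p := by
    rw [Set.image_eq_range]
  have hlinks : ∀ j ≠ (⊥ : Set.Iic p),
      linkBound ℓ k ≤ (outerLinks G (w' '' Set.Iio j) (w' j) \ Set.range w').ncard := by
    intro j hj
    rw [image_Iio, range_eq]
    have j_pos : 0 < j.1 := Nat.pos_of_ne_zero fun h =>
      hj (IsMin.eq_bot fun i _ => h.trans_le i.1.zero_le)
    exact linkBound_le_ncard_outerLinks_diff (hw.le_ncard_outerLinks j j.2 j_pos) (hlater j j.2)
  calc {j | j ≤ p ∧ G.Adj (w i) (w j)}.ncard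
      ≤ (Subtype.val '' {j | G.Adj (w' ⟨i, hi⟩) (w' j)}).ncard :=
        Set.ncard_le_ncard (fun j hj => ⟨⟨j, hj.1⟩, hj.2, rfl⟩) (Set.toFinite _)
    _ = _ := Set.ncard_image_of_injective _ Subtype.val_injective
    _ ≤ 2 * ℓ := ncard_adj_hub_le hℓ hG hw.injOn.injective hlinks ⟨i, hi⟩

lemma IsHubSequence.ncard_adj_le (hw : IsHubSequence G (hubBound ℓ k) w p) (hℓ : 1 ≤ ℓ)
    (hG : ¬ IsMinor (dominatedStars ℓ k) G) (hi : i ≤ p) :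
    {j | j ≤ p ∧ G.Adj (w i) (w j)}.ncard ≤ 2 * ℓ := by
  have last : ∀ q, {j | q ≤ j ∧ j ≤ q ∧ G.Adj (w q) (w j)}.ncard ≤ 2 * ℓ + 1 := by
    intro q
    have empty : {j | q ≤ j ∧ j ≤ q ∧ G.Adj (w q) (w j)} = ∅ :=
      Set.eq_empty_of_forall_notMem fun j hj => hj.2.2.ne (congrArg w (le_antisymm hj.1 hj.2.1))
    exact (empty ▸ Set.ncard_empty ℕ).trans_le (Nat.zero_le _)
  induction p generalizing i with
  | zero =>
    refine hw.ncard_adj_le_of_later hℓ hG (fun i hi => ?_) hi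
    exact Nat.le_zero.1 hi ▸ last 0
  | succ p ih =>
    refine hw.ncard_adj_le_of_later hℓ hG (fun i hi => ?_) hi
    rcases hi.lt_or_eq with hip | rfl
    · have subset : {j | i ≤ j ∧ j ≤ p + 1 ∧ G.Adj (w i) (w j)} ⊆
          insert (p + 1) {j | j ≤ p ∧ G.Adj (w i) (w j)} := fun j hj => by grind
      have finite : {j | j ≤ p ∧ G.Adj (w i) (w j)}.Finite :=
        (Set.finite_Iic p).subset fun j hj => hj.1
      exact (Set.ncard_le_ncard subset (finite.insert _)).trans ((Set.ncard_insert_le _ _).trans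
        (Nat.succ_le_succ (ih hw.of_succ (Nat.lt_succ_iff.1 hip))))
    · exact last (p + 1)

end Degrees

lemma IsHubSequence.update_succ (hw : IsHubSequence G s w p) (hx : x ∉ w '' Set.Iic p)
    (h : s ≤ (outerLinks G (w '' Set.Iic p) x).ncard) :
    IsHubSequence G s (Function.update w (p + 1) x) (p + 1) := by
  have Iic_eq : Set.Iic (p + 1) = insert (p + 1) (Set.Iic p) := Order.Iic_succ p
  have update_eq : Set.EqOn (Function.update w (p + 1) x) w (Set.Iic p) := fun i hi =>
    Function.update_of_ne (Nat.lt_succ_of_le hi).ne _ _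
  constructor
  · rw [Iic_eq, Set.injOn_insert (by simp)]
    refine ⟨hw.injOn.congr update_eq.symm, ?_⟩
    rwa [update_eq.image_eq, Function.update_self]
  · intro i hi hi₀
    rcases hi.lt_or_eq with hi | rfl
    · have hip := Nat.lt_succ_iff.1 hi
      rw [(update_eq.mono fun j hj => (hj.le.trans hip)).image_eq, update_eq hip]
      exact hw.le_ncard_outerLinks i hip hi₀
    · rwa [Set.Iio_add_one_eq_Iic, update_eq.image_eq, Function.update_self]

lemma exists_maximal_isHubSequence [Finite V] (G : SimpleGraph V) (s : ℕ) (r : V) :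
    ∃ w p, w 0 = r ∧ IsHubSequence G s w p ∧
      ∀ x ∉ w '' Set.Iic p, (outerLinks G (w '' Set.Iic p) x).ncard < s := by
  by_contra! h
  have exists_long : ∀ p, ∃ w, w 0 = r ∧ IsHubSequence G s w p := by
    intro p
    induction p with
    | zero => exact ⟨fun _ => r, rfl, isHubSequence_zero G s _⟩
    | succ p ih =>
      obtain ⟨w, hr, hw⟩ := ih
      obtain ⟨x, hx, hxs⟩ := h w p hr hw
      exact ⟨Function.update w (p + 1) x, hr ▸ Function.update_of_ne p.succ_ne_zero.symm _ _,
        hw.update_succ hx hxs⟩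
  obtain ⟨w, -, hw⟩ := exists_long (Nat.card V)
  have := Set.ncard_le_card (w '' Set.Iic (Nat.card V))
  rw [hw.injOn.ncard_image, ← Nat.card_coe_set_eq] at this
  simp at this

/-- The vertices of `W` and their neighbours. -/
def closedNbhd (G : SimpleGraph V) (W : Set V) : Set V :=
  {x | x ∈ W ∨ ∃ u ∈ W, G.Adj x u}

lemma IsHubSequence.connected_induce_closedNbhd (hw : IsHubSequence G s w p) (hs : 0 < s) :
    (G.induce (closedNbhd G (w '' Set.Iic p))).Connected := by
  have mem : ∀ i ≤ p, w i ∈ closedNbhd G (w '' Set.Iic p) := fun i hi => Or.inl ⟨i, hi, rfl⟩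
  have reach : ∀ i ≤ p, ReachableIn G (closedNbhd G (w '' Set.Iic p)) (w 0) (w i) := by
    intro i
    induction i using Nat.strong_induction_on with | _ i ih
    intro hi
    rcases i.eq_zero_or_pos with rfl | hi₀
    · exact .refl G _ _
    · obtain ⟨b, -, hib, _, ⟨j, hj, rfl⟩, hbj⟩ := Set.nonempty_of_ncard_ne_zero
        (hs.trans_le (hw.le_ncard_outerLinks i hi hi₀)).ne'
      have hjp : j ≤ p := hj.le.trans hi
      exact ((ih j hj hjp).tail hbj.symm (Or.inr ⟨w j, ⟨j, hjp, rfl⟩, hbj⟩)).tail hib.symm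
        (mem i hi)
  refine connected_induce_of_reachableIn (mem 0 p.zero_le) ?_
  rintro x (⟨i, hi, rfl⟩ | ⟨_, ⟨i, hi, rfl⟩, hxi⟩)
  · exact reach i hi
  · exact (reach i hi).tail hxi.symm (Or.inr ⟨w i, ⟨i, hi, rfl⟩, hxi⟩)

/-- A set `W` that contains `r`, has connected closed neighbourhood, induces a graph of maximum
degree at most `a`, and outside of which each vertex has at most `s` links to `W`. -/
structure IsHubSet (G : SimpleGraph V) (r : V) (a s : ℕ) (W : Set V) : Prop where
  root_mem : r ∈ W
  ncard_neighborSet_inter_le : ∀ x ∈ W, (G.neighborSet x ∩ W).ncard ≤ a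
  ncard_outerLinks_le : ∀ x ∉ W, (outerLinks G W x).ncard ≤ s
  connected_closedNbhd : (G.induce (closedNbhd G W)).Connected

theorem exists_isHubSet [Finite V] (hℓ : 1 ≤ ℓ) (hG : ¬ IsMinor (dominatedStars ℓ k) G) (r : V) :
    ∃ W, IsHubSet G r (2 * ℓ) (hubBound ℓ k) W := by
  obtain ⟨w, p, rfl, hw, hmax⟩ := exists_maximal_isHubSequence G (hubBound ℓ k) r
  refine ⟨w '' Set.Iic p, ⟨0, p.zero_le, rfl⟩, ?_, fun x hx => (hmax x hx).le,
    hw.connected_induce_closedNbhd (Nat.succ_pos _)⟩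
  rintro _ ⟨i, hi, rfl⟩
  have subset : G.neighborSet (w i) ∩ w '' Set.Iic p ⊆ w '' {j | j ≤ p ∧ G.Adj (w i) (w j)} := by
    rintro _ ⟨hadj, j, hj, rfl⟩
    exact ⟨j, ⟨hj, hadj⟩, rfl⟩
  calc _ ≤ _ := Set.ncard_le_ncard subset
    _ ≤ _ := Set.ncard_image_le ((Set.finite_Iic p).subset fun j hj => hj.1)
    _ ≤ 2 * ℓ := hw.ncard_adj_le hℓ hG hi

end Hubs

section RootedColourings

variable {V : Type*} {G : SimpleGraph V} {r v x y : V} {a d s : ℕ} {W : Set V}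

/-- The neighbours of `v` that have the colour of `v`. -/
def sameColour (G : SimpleGraph V) (c : V → Bool) (v : V) : Set V :=
  {y | G.Adj v y ∧ c y = c v}

lemma mem_sameColour_comm {c : V → Bool} : y ∈ sameColour G c x ↔ x ∈ sameColour G c y :=
  ⟨fun h => ⟨h.1.symm, h.2.symm⟩, fun h => ⟨h.1.symm, h.2.symm⟩⟩

/-- A two-colouring of defect `d` whose defect is at most `a` at the root `r` and at the neighbours
of `r` of the same colour. -/
structure IsRootedColouring (G : SimpleGraph V) (r : V) (a d : ℕ) (c : V → Bool) : Prop where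
  ncard_le_of_root : ∀ v ∈ insert r (sameColour G c r), (sameColour G c v).ncard ≤ a
  ncard_le : ∀ v, (sameColour G c v).ncard ≤ d

lemma mem_closedNbhd_of_adj (hx : x ∈ W) (hxy : G.Adj x y) : y ∈ closedNbhd G W :=
  Or.inr ⟨x, hx, hxy.symm⟩

section

open scoped Classical in
/-- The vertex of the contraction of `U` that `v` is contracted to. -/
noncomputable def toContractSet (U : Set V) (v : V) : Option {z // z ∉ U} :=
  if h : v ∈ U then none else some ⟨v, h⟩

lemma toContractSet_of_mem {U : Set V} (h : v ∈ U) : toContractSet U v = none :=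
  dif_pos h

lemma toContractSet_of_notMem {U : Set V} (h : v ∉ U) : toContractSet U v = some ⟨v, h⟩ :=
  dif_neg h

lemma contractSet_adj_toContractSet {U : Set V} (hxy : G.Adj x y) (h : x ∉ U ∨ y ∉ U) :
    (contractSet G U).Adj (toContractSet U x) (toContractSet U y) := by
  by_cases hx : x ∈ U
  · have hy := h.resolve_left (not_not.2 hx)
    rw [toContractSet_of_mem hx, toContractSet_of_notMem hy]
    exact contractSet_adj_none_some.2 ⟨x, hx, hxy⟩
  · rw [toContractSet_of_notMem hx]
    by_cases hy : y ∈ U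
    · rw [toContractSet_of_mem hy]
      exact contractSet_adj_some_none.2 ⟨y, hy, hxy⟩
    · rw [toContractSet_of_notMem hy]
      exact contractSet_adj_some_some.2 hxy

open scoped Classical in
/-- The colouring that gives the vertices outside `W` the colour of their image in the contraction
of the closed neighbourhood of `W`, and those in `W` the colour that this neighbourhood has not. -/
noncomputable def extendColouring (G : SimpleGraph V) (W : Set V)
    (c : Option {z // z ∉ closedNbhd G W} → Bool) (v : V) : Bool :=
  if v ∈ W then !c none else c (toContractSet (closedNbhd G W) v)

variable {c : Option {z // z ∉ closedNbhd G W} → Bool}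

lemma extendColouring_of_mem (h : v ∈ W) : extendColouring G W c v = !c none :=
  if_pos h

lemma extendColouring_of_notMem (h : v ∉ W) :
    extendColouring G W c v = c (toContractSet (closedNbhd G W) v) :=
  if_neg h

lemma extendColouring_ne_of_adj (hx : x ∈ W) (hy : y ∉ W) (hxy : G.Adj x y) :
    extendColouring G W c x ≠ extendColouring G W c y := by
  rw [extendColouring_of_mem hx, extendColouring_of_notMem hy,
    toContractSet_of_mem (mem_closedNbhd_of_adj hx hxy)]
  exact Bool.not_ne_self _

lemma sameColour_extendColouring_subset_of_mem (hv : v ∈ W) :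
    sameColour G (extendColouring G W c) v ⊆ G.neighborSet v ∩ W :=
  fun _ h => ⟨h.1, by_contra fun hy => extendColouring_ne_of_adj hv hy h.1 h.2.symm⟩

lemma notMem_of_mem_sameColour_extendColouring (hv : v ∉ W)
    (hy : y ∈ sameColour G (extendColouring G W c) v) : y ∉ W :=
  fun h => extendColouring_ne_of_adj h hv hy.1.symm hy.2

lemma toContractSet_mem_sameColour (hv : v ∉ W)
    (hy : y ∈ sameColour G (extendColouring G W c) v)
    (h : v ∉ closedNbhd G W ∨ y ∉ closedNbhd G W) :
    toContractSet (closedNbhd G W) y ∈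
      sameColour (contractSet G (closedNbhd G W)) c (toContractSet (closedNbhd G W) v) := by
  have hyW := notMem_of_mem_sameColour_extendColouring hv hy
  exact ⟨contractSet_adj_toContractSet hy.1 h, ((extendColouring_of_notMem hyW).symm.trans
    hy.2).trans (extendColouring_of_notMem hv)⟩

lemma ncard_sameColour_extendColouring_diff_le [Finite V] (hv : v ∉ W) :
    (sameColour G (extendColouring G W c) v \ closedNbhd G W).ncard ≤
      (sameColour (contractSet G (closedNbhd G W)) c
        (toContractSet (closedNbhd G W) v)).ncard := by
  refine Set.ncard_le_ncard_of_injOn (toContractSet (closedNbhd G W))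
    (fun y hy => toContractSet_mem_sameColour hv hy.1 (Or.inr hy.2)) fun x hx y hy h => ?_
  rw [toContractSet_of_notMem hx.2, toContractSet_of_notMem hy.2] at h
  exact congrArg Subtype.val (Option.some_injective _ h)

lemma ncard_sameColour_extendColouring_le_of_notMem [Finite V] (hW : IsHubSet G r a s W)
    (hc : IsRootedColouring (contractSet G (closedNbhd G W)) none a (s + a) c) (hv : v ∉ W) :
    (sameColour G (extendColouring G W c) v).ncard ≤ s + a := by
  have outside := ncard_sameColour_extendColouring_diff_le (G := G) (c := c) hv
  by_cases h : v ∉ closedNbhd G W ∧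
      Disjoint (sameColour G (extendColouring G W c) v) (closedNbhd G W)
  · rw [h.2.sdiff_eq_left] at outside
    exact outside.trans (hc.ncard_le _)
  · have near_root : toContractSet (closedNbhd G W) v ∈
        insert none (sameColour (contractSet G (closedNbhd G W)) c none) := by
      by_cases hvU : v ∈ closedNbhd G W
      · exact Or.inl (toContractSet_of_mem hvU)
      · obtain ⟨y, hy, hyU⟩ := Set.not_disjoint_iff.1 (not_and.1 h hvU)
        exact Or.inr (mem_sameColour_comm.1
          (toContractSet_of_mem hyU ▸ toContractSet_mem_sameColour hv hy (Or.inl hvU)))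
    have inside : (sameColour G (extendColouring G W c) v ∩ closedNbhd G W).ncard ≤ s := by
      refine (Set.ncard_le_ncard fun y hy => ?_).trans (hW.ncard_outerLinks_le v hv)
      have hyW := notMem_of_mem_sameColour_extendColouring hv hy.1
      exact ⟨hyW, hy.1.1, hy.2.resolve_left hyW⟩
    rw [← Set.ncard_inter_add_ncard_sdiff_eq_ncard _ (closedNbhd G W)]
    exact Nat.add_le_add inside (outside.trans (hc.ncard_le_of_root _ near_root))

lemma IsHubSet.isRootedColouring_extendColouring [Finite V] (hW : IsHubSet G r a s W)
    (hc : IsRootedColouring (contractSet G (closedNbhd G W)) none a (s + a) c) :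
    IsRootedColouring G r a (s + a) (extendColouring G W c) := by
  have le_of_mem : ∀ v ∈ W, (sameColour G (extendColouring G W c) v).ncard ≤ a := fun v hv =>
    (Set.ncard_le_ncard (sameColour_extendColouring_subset_of_mem hv)).trans
      (hW.ncard_neighborSet_inter_le v hv)
  refine ⟨?_, fun v => ?_⟩
  · rintro v (rfl | hv)
    · exact le_of_mem v hW.root_mem
    · exact le_of_mem v (sameColour_extendColouring_subset_of_mem hW.root_mem hv).2
  · by_cases hv : v ∈ W
    · exact (le_of_mem v hv).trans (Nat.le_add_left a s)
    · exact ncard_sameColour_extendColouring_le_of_notMem hW hc hv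

end

lemma IsRootedColouring.of_isolated {c : V → Bool} (hr : ∀ x, ¬ G.Adj r x)
    (hc : ∀ v, (sameColour G c v).ncard ≤ d) : IsRootedColouring G r a d c := by
  have empty : sameColour G c r = ∅ := Set.eq_empty_of_forall_notMem fun x hx => hr x hx.1
  refine ⟨?_, hc⟩
  rw [empty]
  rintro v (rfl | ⟨⟨⟩⟩)
  exact (empty ▸ Set.ncard_empty V).trans_le (Nat.zero_le a)

/-- Contract the closed neighbourhood of a hub set to a root, colour the contraction recursively,
and give the hub set the colour that the root has not. -/
theorem exists_isRootedColouring {V : Type u} [Finite V] {G : SimpleGraph V}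
    (hG : ∀ (X : Type u) (Q : SimpleGraph X), Finite X → IsMinor Q G →
      ∀ r, ∃ W, IsHubSet Q r a s W) (r : V) :
    ∃ c, IsRootedColouring G r a (s + a) c := by
  induction hn : Nat.card V using Nat.strong_induction_on generalizing V with | _ n ih
  have exists_of_adj : ∀ r x, G.Adj r x → ∃ c, IsRootedColouring G r a (s + a) c := by
    intro r x hrx
    obtain ⟨W, hW⟩ := hG V G ‹_› (isMinor_of_isContained .rfl) r
    have isMinor := isMinor_contractSet hW.connected_closedNbhd
    have two_le : 2 ≤ (closedNbhd G W).ncard := by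
      rw [← Set.ncard_pair hrx.ne]
      exact Set.ncard_le_ncard
        (Set.pair_subset (Or.inl hW.root_mem) (mem_closedNbhd_of_adj hW.root_mem hrx))
    have := card_contractSet_add_ncard (closedNbhd G W)
    obtain ⟨c, hc⟩ := ih _ (by omega) (fun X Q hX hQ => hG X Q hX (hQ.trans isMinor)) none rfl
    exact ⟨_, hW.isRootedColouring_extendColouring hc⟩
  by_cases hr : ∃ x, G.Adj r x
  · exact hr.elim (exists_of_adj r)
  · push Not at hr
    obtain rfl | hne := eq_or_ne G ⊥
    · have empty : ∀ v, sameColour (⊥ : SimpleGraph V) (fun _ => true) v = ∅ := fun v =>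
        Set.eq_empty_of_forall_notMem fun x hx => hx.1
      exact ⟨fun _ => true, .of_isolated hr fun v => by simp [empty v]⟩
    · obtain ⟨r', x, hrx⟩ := SimpleGraph.ne_bot_iff_exists_adj.1 hne
      obtain ⟨c, hc⟩ := exists_of_adj r' x hrx
      exact ⟨c, .of_isolated hr hc.ncard_le⟩

end RootedColourings

section DefectColourable

variable {V : Type u} {G : SimpleGraph V} {k d d' ℓ : ℕ}

lemma DefectColourable.mono (h : DefectColourable G k d) (hd : d ≤ d') :
    DefectColourable G k d' :=
  h.imp fun _ hc x => (hc x).trans (Nat.cast_le.2 hd)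

lemma defectColourable_two_of_bool [Finite V] {c : V → Bool}
    (hc : ∀ v, (sameColour G c v).ncard ≤ d) : DefectColourable G 2 d := by
  refine ⟨finTwoEquiv.symm ∘ c, fun v => ?_⟩
  simp only [Function.comp_apply, EmbeddingLike.apply_eq_iff_eq]
  rw [← (Set.toFinite _).cast_ncard_eq]
  exact Nat.cast_le.2 (hc v)

theorem defectColourable_two_of_minorFree_dominatedStars (hℓ : 1 ≤ ℓ)
    (hG : MinorFree (dominatedStars ℓ k) V G) :
    DefectColourable G 2 (hubBound ℓ k + 2 * ℓ) := by
  obtain ⟨_, hG⟩ := hG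
  cases isEmpty_or_nonempty V with
  | inl _ => exact ⟨isEmptyElim, isEmptyElim⟩
  | inr hV =>
    obtain ⟨c, hc⟩ := exists_isRootedColouring (G := G)
      (fun X Q _ hQ => exists_isHubSet hℓ fun h => hG (h.trans hQ)) hV.some
    exact defectColourable_two_of_bool hc.ncard_le

lemma hubBound_add_le {ℓ k : ℕ} (hℓ : 1 ≤ ℓ) (hk : 1 ≤ k) :
    hubBound ℓ k + 2 * ℓ ≤ 17 * ℓ ^ 2 * k ^ 2 := by
  have pow_le : ∀ {i j}, i ≤ 2 → j ≤ 2 → ℓ ^ i * k ^ j ≤ ℓ ^ 2 * k ^ 2 := fun hi hj =>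
    Nat.mul_le_mul (Nat.pow_le_pow_right hℓ hi) (Nat.pow_le_pow_right hk hj)
  calc hubBound ℓ k + 2 * ℓ
      = 2 * (ℓ ^ 2 * k ^ 2) + 4 * (ℓ ^ 2 * k ^ 1) + 2 * (ℓ ^ 1 * k ^ 1) + 8 * (ℓ ^ 1 * k ^ 0) +
        ℓ ^ 0 * k ^ 0 := by
        unfold hubBound linkBound
        ring
    _ ≤ 2 * (ℓ ^ 2 * k ^ 2) + 4 * (ℓ ^ 2 * k ^ 2) + 2 * (ℓ ^ 2 * k ^ 2) +
        8 * (ℓ ^ 2 * k ^ 2) + ℓ ^ 2 * k ^ 2 := by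
      gcongr 2 * (ℓ ^ 2 * k ^ 2) + 4 * ?_ + 2 * ?_ + 8 * ?_ + ?_ <;> apply pow_le <;> norm_num
    _ = 17 * ℓ ^ 2 * k ^ 2 := by ring

end DefectColourable

section TreeDepth

variable {V W : Type*}

section TreeClosure

variable {T : SimpleGraph V} {r x y : V} {n : ℕ}

lemma eq_root_of_isAncestor (hlen : ∀ y (p : T.Path r y), (p : T.Walk r y).length ≤ 1)
    (h : IsAncestor T r x y) (hxy : x ≠ y) : x = r := by
  obtain ⟨p, hx⟩ := h
  obtain ⟨i, rfl, hi⟩ := SimpleGraph.Walk.mem_support_iff_exists_getVert.1 hx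
  have hi' : i ≠ (p : T.Walk r y).length := fun h => hxy (h ▸ SimpleGraph.Walk.getVert_length _)
  have hi0 : i = 0 := by
    have := hlen y p
    omega
  rw [hi0, SimpleGraph.Walk.getVert_zero]

lemma snd_eq_of_isAncestor (hlen : ∀ y (p : T.Path r y), (p : T.Walk r y).length ≤ 2)
    {p : T.Path r y} (hx : x ∈ (p : T.Walk r y).support) (hxr : x ≠ r) (hxy : x ≠ y) :
    (p : T.Walk r y).snd = x := by
  obtain ⟨i, rfl, hi⟩ := SimpleGraph.Walk.mem_support_iff_exists_getVert.1 hx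
  have hi₀ : i ≠ 0 := fun h => hxr (h ▸ SimpleGraph.Walk.getVert_zero _)
  have hi₁ : i ≠ (p : T.Walk r y).length := fun h => hxy (h ▸ SimpleGraph.Walk.getVert_length _)
  have hi1 : i = 1 := by
    have := hlen y p
    omega
  rw [hi1]

lemma treeClosure_isContained_star (hlen : ∀ y (p : T.Path r y), (p : T.Walk r y).length ≤ 1)
    (e : V ↪ Fin n) :
    (treeClosure T r).IsContained (completeBipartiteGraph (Fin 1) (Fin n)) := by
  classical
  let f : V → Fin 1 ⊕ Fin n := fun x => if x = r then Sum.inl 0 else Sum.inr (e x)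
  have root_mem : ∀ {x y}, (treeClosure T r).Adj x y → x = r ∨ y = r := fun h =>
    h.2.imp (eq_root_of_isAncestor hlen · h.1) (eq_root_of_isAncestor hlen · h.1.symm)
  refine ⟨⟨⟨f, fun {x y} hxy => ?_⟩, fun x y hxy => ?_⟩⟩
  · have hne := hxy.ne
    rcases root_mem hxy with rfl | rfl
    · simp [f, hne.symm]
    · simp [f, hne]
  · dsimp [f] at hxy
    split_ifs at hxy <;> simp_all

lemma exists_forall_path_snd_eq (hT : T.IsTree) (r : V) :
    ∃ branch : V → V, ∀ y (p : T.Path r y), (p : T.Walk r y).snd = branch y := by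
  choose p hp using hT.1.exists_isPath r
  refine ⟨fun y => (p y).snd, fun y q => ?_⟩
  rw [(hT.2.subsingleton_path r y).elim q ⟨p y, hp y⟩]

lemma treeClosure_isContained_dominatedStars (hT : T.IsTree)
    (hlen : ∀ y (p : T.Path r y), (p : T.Walk r y).length ≤ 2) (e : V ↪ Fin n) :
    (treeClosure T r).IsContained (dominatedStars n n) := by
  classical
  obtain ⟨branch, hbranch⟩ := exists_forall_path_snd_eq hT r
  have branch_eq : ∀ {x y}, x ≠ r → x ≠ y → IsAncestor T r x y →
      branch x = x ∧ branch y = x := by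
    rintro x y hxr hxy ⟨p, hx⟩
    have hsnd := snd_eq_of_isAncestor hlen hx hxr hxy
    refine ⟨?_, (hbranch y p).symm.trans hsnd⟩
    rw [← hbranch x ⟨_, p.2.takeUntil hx⟩, SimpleGraph.Walk.snd_takeUntil hxr, hsnd]
  let f : V → Option (Fin n × (Fin 1 ⊕ Fin n)) := fun x =>
    if x = r then none
    else some (e (branch x), if branch x = x then Sum.inl 0 else Sum.inr (e x))
  have f_adj : ∀ {x y}, x ≠ y → IsAncestor T r x y → (dominatedStars n n).Adj (f x) (f y) := by
    intro x y hxy hanc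
    by_cases hxr : x = r
    · simp [f, dominatedStars, addDominant, hxr, (hxr ▸ hxy).symm]
    · obtain ⟨hx, hy⟩ := branch_eq hxr hxy hanc
      by_cases hyr : y = r
      · simp [f, dominatedStars, addDominant, hxr, hyr]
      · simp [f, dominatedStars, addDominant, disjointCopies, hxr, hyr, hx, hy, hxy]
  refine ⟨⟨⟨f, fun ⟨hne, hanc⟩ => hanc.elim (f_adj hne) fun h => (f_adj hne.symm h).symm⟩, ?_⟩⟩
  intro x y hxy
  dsimp [f] at hxy
  split_ifs at hxy <;> simp_all

end TreeClosure

lemma length_le_of_treeHeight_le {T : SimpleGraph V} {r : V} {h : ℕ}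
    (hT : treeHeight T r ≤ (h + 1 : ℕ)) {y : V} (p : T.Path r y) : (p : T.Walk r y).length ≤ h := by
  have hp : ((p : T.Walk r y).support.length : ℕ∞) ≤ (h + 1 : ℕ) :=
    (le_iSup₂ (f := fun y (p : T.Path r y) => ((p : T.Walk r y).support.length : ℕ∞)) y p).trans hT
  rw [SimpleGraph.Walk.length_support] at hp
  exact Nat.le_of_succ_le_succ (Nat.cast_le.1 hp)

lemma exists_isTree_of_connectedTreeDepth_le {C : SimpleGraph W} {h : ℕ}
    (hC : connectedTreeDepth C ≤ (h + 1 : ℕ)) :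
    ∃ (n : ℕ) (T : SimpleGraph (Fin n)) (r : Fin n), T.IsTree ∧
      (∀ y (p : T.Path r y), (p : T.Walk r y).length ≤ h) ∧ C.IsContained (treeClosure T r) := by
  have hne : {h : ℕ∞ | ∃ (n : ℕ) (T : SimpleGraph (Fin n)) (r : Fin n),
      T.IsTree ∧ treeHeight T r = h ∧ C.IsContained (treeClosure T r)}.Nonempty := by
    by_contra! hempty
    rw [connectedTreeDepth, hempty, sInf_empty] at hC
    exact absurd hC (by simp)
  obtain ⟨n, T, r, hT, hheight, hcont⟩ := csInf_mem hne
  exact ⟨n, T, r, hT, fun _ p => length_le_of_treeHeight_le (hheight.trans_le hC) p, hcont⟩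

lemma eventually_isContained_star {C : SimpleGraph W} (hC : connectedTreeDepth C ≤ 2) :
    ∀ᶠ n in Filter.atTop, C.IsContained (completeBipartiteGraph (Fin 1) (Fin n)) := by
  obtain ⟨m, T, r, -, hlen, hcont⟩ := exists_isTree_of_connectedTreeDepth_le (h := 1) hC
  filter_upwards [Filter.eventually_ge_atTop m] with n hmn
  exact hcont.trans (treeClosure_isContained_star hlen (Fin.castLEEmb hmn))

lemma eventually_isContained_dominatedStars {C : SimpleGraph W} (hC : connectedTreeDepth C ≤ 3) :
    ∀ᶠ n in Filter.atTop, C.IsContained (dominatedStars n n) := by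
  obtain ⟨m, T, r, hT, hlen, hcont⟩ := exists_isTree_of_connectedTreeDepth_le (h := 2) hC
  filter_upwards [Filter.eventually_ge_atTop m] with n hmn
  exact hcont.trans (treeClosure_isContained_dominatedStars hT hlen (Fin.castLEEmb hmn))

lemma isContained_of_connectedComponent {H : SimpleGraph W} {G : SimpleGraph V}
    (f : ∀ c : H.ConnectedComponent, SimpleGraph.Copy c.toSimpleGraph G)
    (hf : ∀ c₁ c₂ x₁ x₂, f c₁ x₁ = f c₂ x₂ → c₁ = c₂) : H.IsContained G := by
  refine ⟨⟨H.homOfConnectedComponents fun c => (f c).toHom, fun x y hxy => ?_⟩⟩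
  have hom_apply : ∀ c (hy : y ∈ c.supp),
      H.homOfConnectedComponents (fun c => (f c).toHom) y = f c ⟨y, hy⟩ := by
    rintro _ rfl
    rfl
  have hc : H.connectedComponentMk y = H.connectedComponentMk x := (hf _ _ _ _ hxy).symm
  exact congrArg Subtype.val ((f _).injective (hxy.trans (hom_apply _ hc)))

lemma exists_copy_dominatedStars_of_embedding {ℓ ℓ' k : ℕ} (e : Fin ℓ ↪ Fin ℓ') :
    ∃ f : SimpleGraph.Copy (dominatedStars ℓ k) (dominatedStars ℓ' k),
      ∀ x, f x = x.map (Prod.map e id) := by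
  have inj : Function.Injective (Option.map (Prod.map e (id : Fin 1 ⊕ Fin k → _))) :=
    Option.map_injective (e.injective.prodMap Function.injective_id)
  refine ⟨⟨⟨_, fun hxy => ⟨inj.ne hxy.1, fun a b ha hb => ?_⟩⟩, inj⟩, fun _ => rfl⟩
  obtain ⟨a, rfl, rfl⟩ := Option.map_eq_some_iff.1 ha
  obtain ⟨b, rfl, rfl⟩ := Option.map_eq_some_iff.1 hb
  obtain ⟨hi, hadj⟩ := hxy.2 a b rfl rfl
  exact ⟨congrArg e hi, hadj⟩

lemma exists_copy_star_dominatedStars {ℓ k : ℕ} (i : Fin ℓ) :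
    ∃ f : SimpleGraph.Copy (completeBipartiteGraph (Fin 1) (Fin k)) (dominatedStars ℓ k),
      ∀ x, f x = some (i, x) := by
  refine ⟨⟨⟨fun x => some (i, x), fun {x y} hxy => ⟨by simpa using hxy.ne, ?_⟩⟩, ?_⟩, fun _ => rfl⟩
  · rintro _ _ ⟨⟩ ⟨⟩
    exact ⟨rfl, hxy⟩
  · exact fun x y hxy => (Prod.mk.inj (Option.some.inj hxy)).2

lemma exists_isContained_dominatedStars [Finite W] {H : SimpleGraph W} (hH : treeDepth H ≤ 3)
    (huniq : ∀ c₁ c₂ : H.ConnectedComponent, connectedTreeDepth c₁.toSimpleGraph = 3 →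
      connectedTreeDepth c₂.toSimpleGraph = 3 → c₁ = c₂) :
    ∃ ℓ k, 1 ≤ ℓ ∧ H.IsContained (dominatedStars ℓ k) := by
  classical
  have depth_le_three : ∀ c : H.ConnectedComponent, connectedTreeDepth c.toSimpleGraph ≤ 3 :=
    iSup_le_iff.1 hH
  have depth_le_two : ∀ c : H.ConnectedComponent, connectedTreeDepth c.toSimpleGraph ≠ 3 →
      connectedTreeDepth c.toSimpleGraph ≤ 2 := fun c hc =>
    (ENat.lt_add_one_iff (by simp)).1 ((depth_le_three c).lt_of_ne hc)
  obtain ⟨n, hn, hdom, hstar⟩ := ((Filter.eventually_ge_atTop 1).and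
    ((Filter.eventually_all.2 fun c => eventually_isContained_dominatedStars (depth_le_three c)).and
      (Filter.eventually_all.2 fun c => Filter.eventually_all.2 fun hc =>
        eventually_isContained_star (depth_le_two c hc)))).exists
  set m := Nat.card H.ConnectedComponent
  have e : H.ConnectedComponent ≃ Fin m := Finite.equivFin _
  let tag : Option (Fin (n + m) × (Fin 1 ⊕ Fin n)) → Option (Fin m) := fun o =>
    o.bind fun x => Fin.addCases (fun _ => none) some x.1
  have exists_copy : ∀ c, ∃ f : SimpleGraph.Copy c.toSimpleGraph (dominatedStars (n + m) n),
      ∀ x, tag (f x) = if connectedTreeDepth c.toSimpleGraph = 3 then none else some (e c) := by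
    intro c
    split_ifs with hc
    · obtain ⟨g⟩ := hdom c
      obtain ⟨f, hf⟩ := exists_copy_dominatedStars_of_embedding (k := n) (Fin.castAddEmb (n := n) m)
      refine ⟨f.comp g, fun x => ?_⟩
      rcases hx : g x <;> simp [hf, hx, tag]
    · obtain ⟨g⟩ := hstar c hc
      obtain ⟨f, hf⟩ := exists_copy_star_dominatedStars (k := n) (Fin.natAdd n (e c))
      exact ⟨f.comp g, fun x => by simp [hf, tag]⟩
  choose f hf using exists_copy
  refine ⟨n + m, n, by omega, isContained_of_connectedComponent f fun c₁ c₂ x₁ x₂ h => ?_⟩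
  have htag := (hf c₁ x₁).symm.trans ((congrArg tag h).trans (hf c₂ x₂))
  split_ifs at htag with h₁ h₂
  · exact huniq c₁ c₂ h₁ h₂
  · exact e.injective (Option.some.inj htag)

end TreeDepth

section LowerBound

variable {V W : Type*}

lemma starGraph_le_treeClosure {T : SimpleGraph V} (hT : T.Connected) (r : V) :
    SimpleGraph.starGraph r ≤ treeClosure T r := by
  have root_isAncestor : ∀ y, IsAncestor T r r y := fun y => by
    obtain ⟨p, hp⟩ := hT.exists_isPath r y
    exact ⟨⟨p, hp⟩, SimpleGraph.Walk.start_mem_support _⟩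
  intro x y hxy
  obtain ⟨hne, rfl | rfl⟩ := SimpleGraph.starGraph_adj.1 hxy
  · exact ⟨hne, Or.inl (root_isAncestor y)⟩
  · exact ⟨hne, Or.inr (root_isAncestor x)⟩

lemma treeHeight_starGraph_le_two (r : V) : treeHeight (SimpleGraph.starGraph r) r ≤ 2 := by
  refine iSup₂_le fun y p => ?_
  have path_unique := (SimpleGraph.isTree_starGraph r).2.subsingleton_path r y
  by_cases hy : r = y
  · subst hy
    rw [path_unique.elim p SimpleGraph.Path.nil]
    simp [SimpleGraph.Path.nil]
  · rw [path_unique.elim p (SimpleGraph.Path.singleton (SimpleGraph.starGraph_center_adj hy))]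
    simp [SimpleGraph.Path.singleton]

lemma connectedTreeDepth_le_two_of_le_starGraph [Finite W] {C : SimpleGraph W} {s : W}
    (hC : C ≤ SimpleGraph.starGraph s) : connectedTreeDepth C ≤ 2 := by
  have e := Finite.equivFin W
  have hT := SimpleGraph.isTree_starGraph (e s)
  have hom : ∀ {x y}, C.Adj x y → (treeClosure _ (e s)).Adj (e x) (e y) := fun {x y} hxy =>
    starGraph_le_treeClosure hT.1 (e s) (by simpa using SimpleGraph.starGraph_adj.1 (hC hxy))
  have hcont : C.IsContained (treeClosure _ (e s)) := ⟨⟨⟨e, hom⟩, e.injective⟩⟩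
  exact (sInf_le ⟨_, _, _, hT, rfl, hcont⟩ : connectedTreeDepth C ≤ _).trans
    (treeHeight_starGraph_le_two (e s))

lemma treeDepth_le_two_of_isMinor_starGraph [Finite W] {H : SimpleGraph W} {o : V}
    (h : IsMinor H (SimpleGraph.starGraph o)) : treeDepth H ≤ 2 := by
  obtain ⟨B, -, hdisj, hadj⟩ := h
  have mem_unique : ∀ {x y}, o ∈ B x → o ∈ B y → x = y := fun hx hy =>
    by_contra fun hne => Set.disjoint_left.1 (hdisj _ _ hne) hx hy
  have mem_of_adj : ∀ {x y}, H.Adj x y → o ∈ B x ∨ o ∈ B y := fun hxy => by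
    obtain ⟨a, ha, b, hb, hab⟩ := hadj _ _ hxy
    obtain ⟨-, rfl | rfl⟩ := SimpleGraph.starGraph_adj.1 hab
    exacts [Or.inl ha, Or.inr hb]
  refine iSup_le fun c => ?_
  by_cases hc : ∃ s : c, o ∈ B s
  · obtain ⟨s, hs⟩ := hc
    refine connectedTreeDepth_le_two_of_le_starGraph (s := s) fun x y hxy => ?_
    exact SimpleGraph.starGraph_adj.2 ⟨hxy.ne, (mem_of_adj hxy).imp
      (Subtype.ext <| mem_unique · hs) (Subtype.ext <| mem_unique · hs)⟩
  · obtain ⟨s, hs⟩ := c.nonempty_supp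
    refine connectedTreeDepth_le_two_of_le_starGraph (s := ⟨s, hs⟩) fun x y hxy => ?_
    exact absurd ((mem_of_adj hxy).elim (⟨x, ·⟩) (⟨y, ·⟩)) hc

lemma two_le_of_defectColourable_starGraph {o : V} {k d : ℕ} (hd : (d + 2 : ℕ) ≤ ENat.card V)
    (h : DefectColourable (SimpleGraph.starGraph o) k d) : 2 ≤ k := by
  obtain ⟨c, hc⟩ := h
  by_contra! hk
  have : Subsingleton (Fin k) := Fin.subsingleton_iff_le_one.2 (by omega)
  have same_colour_eq : {y | (SimpleGraph.starGraph o).Adj o y ∧ c y = c o} = {o}ᶜ := by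
    ext y
    simp [Subsingleton.elim (c y) (c o), eq_comm]
  have card_le : (d + 2 : ℕ) ≤ ((d + 1 : ℕ) : ℕ∞) :=
    calc ((d + 2 : ℕ) : ℕ∞) ≤ ENat.card V := hd
      _ = ({o}ᶜ : Set V).encard + ({o} : Set V).encard := by
        rw [add_comm, Set.encard_add_encard_compl, Set.encard_univ]
      _ ≤ d + 1 := add_le_add (same_colour_eq ▸ hc o) (Set.encard_singleton o).le
      _ = (d + 1 : ℕ) := by simp
  have := Nat.cast_le.1 card_le
  omega

lemma two_le_of_forall_minorFree_defectColourable [Finite W] {H : SimpleGraph W}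
    (hH : 2 < treeDepth H) {k d : ℕ}
    (h : ∀ (V : Type u) (G : SimpleGraph V), MinorFree H V G → DefectColourable G k d) :
    2 ≤ k := by
  let o : ULift.{u} (Fin (d + 2)) := ⟨0⟩
  exact two_le_of_defectColourable_starGraph (o := o) (by simp) <| h _ _
    ⟨inferInstance, fun hm => hH.not_ge (treeDepth_le_two_of_isMinor_starGraph hm)⟩

end LowerBound

end DefectiveColouring

open DefectiveColouring in
theorem mainTheorem11_general :
    (∀ (W : Type v) [Finite W] (H : SimpleGraph W), treeDepth H = 3 →
      (∀ c₁ c₂ : H.ConnectedComponent, connectedTreeDepth c₁.toSimpleGraph = 3 →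
        connectedTreeDepth c₂.toSimpleGraph = 3 → c₁ = c₂) →
      IsDefectiveChromaticNumber.{u} (fun V G => MinorFree H V G) 2) ∧
    (∃ C : ℕ, ∀ ℓ k : ℕ, 1 ≤ ℓ → 1 ≤ k → ∀ (V : Type u) (G : SimpleGraph V),
      MinorFree (dominatedStars ℓ k) V G → DefectColourable G 2 (C * ℓ ^ 2 * k ^ 2)) := by
  refine ⟨fun W _ H hH huniq => ⟨?_, ?_⟩, 17, fun ℓ k hℓ hk V G hG => ?_⟩
  · obtain ⟨ℓ, k, hℓ, hcont⟩ := exists_isContained_dominatedStars hH.le huniq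
    exact ⟨hubBound ℓ k + 2 * ℓ, fun V G ⟨hV, hG⟩ =>
      defectColourable_two_of_minorFree_dominatedStars hℓ
        ⟨hV, fun hm => hG ((isMinor_of_isContained hcont).trans hm)⟩⟩
  · rintro k ⟨d, hd⟩
    exact two_le_of_forall_minorFree_defectColourable (hH ▸ by decide) hd
  · exact (defectColourable_two_of_minorFree_dominatedStars hℓ hG).mono (hubBound_add_le hℓ hk)

theorem mainTheorem11 :
    (∀ (W : Type v) [Finite W] (H : SimpleGraph W),
      DefectiveColouring.treeDepth H = 3 →
      (∀ c₁ c₂ : H.ConnectedComponent,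
        DefectiveColouring.connectedTreeDepth c₁.toSimpleGraph = 3 →
        DefectiveColouring.connectedTreeDepth c₂.toSimpleGraph = 3 → c₁ = c₂) →
      DefectiveColouring.IsDefectiveChromaticNumber.{u}
        (fun V G => DefectiveColouring.MinorFree H V G) 2) ∧
    (∃ C : ℕ, ∀ ℓ k : ℕ, 2 ≤ ℓ → 1 ≤ k →
      ∀ (V : Type u) (G : SimpleGraph V),
        DefectiveColouring.MinorFree (DefectiveColouring.dominatedStars ℓ k) V G →
        DefectiveColouring.DefectColourable G 2 (C * ℓ ^ 10 * k ^ 3)) := by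
  refine mainTheorem11_general.imp_right fun ⟨C, hC⟩ => ⟨C, fun ℓ k hℓ hk V G hG => ?_⟩
  exact (hC ℓ k (by omega) hk V G hG).mono (by gcongr <;> omega)
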